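/- Let $\Gamma$ be a locally compact (Hausdorff) amenable group with left Haar measure $|\cdot|$, let $X$ be a probability space, and let $G$ be a nilpotent group of unitary operators on $L^2(X)$ (real or complex scalars) that act as isometric algebra homomorphisms on $L^\infty(X)$. For a mapping $g\colon\Gamma\to G$ and $a,b\in\Gamma$ let $D_{a,b}g(n)=g(n)^{-1}g(anb)$. The mapping $g$ is called polynomial if there is $d\in\mathbb N$ such that $D_{a_1,b_1}\cdots D_{a_{d+1},b_{d+1}}g\equiv 1_G$ for all $a_1,\dots,a_{d+1},b_1,\dots,b_{d+1}\in\Gamma$. It is called measurable if for every $f\in L^2(X)$ the mappings $n\mapsto g(n)f$ and $n\mapsto g(n)^{-1}f$ from $\Gamma$ to $L^2(X)$ are Bochner (strongly) measurable with respect to Haar measure on every compact subset of $\Gamma$ (if $L^2(X)$ is separable, it suffices to require this of $n\mapsto g(n)f$). A Følner net in $\Gamma$ is a net $(F_\alpha)_{\alpha\in A}$, indexed by a nonempty directed set $A$, of compact subsets of $\Gamma$ of positive measure such that for every compact $K\subset\Gamma$ $$\lim_\alpha\ \sup_{l\in K}\frac{|lF_\alpha\,\triangle\,F_\alpha|}{|F_\alpha|}=0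 .$$ Let $j\ge 0$, let $g_1,\dots,g_j\colon\Gamma\to G$ be measurable polynomial mappings and let $f_0,\dots,f_j\in L^\infty(X)$. Then there is a function $L\in L^2(X)$ such that for every Følner net $(F_\alpha)_{\alpha\in A}$ in $\Gamma$ and every choice of shifts $(a_\alpha)_{\alpha\in A}\subset\Gamma$ the function $m\mapsto f_0\,g_1(m)f_1\cdots g_j(m)f_j$ is Bochner integrable over each $a_\alpha F_\alpha$ as a function with values in $L^2(X)$, and $$\lim_\alpha\ \frac{1}{|a_\alpha F_\alpha|}\int_{m\in a_\alpha F_\alpha} f_0\, g_1(m)f_1\cdots g_j(m)f_j \;=\; L\quad\text{in } L^2(X).$$ In particular, the limit depends neither on the Følner net nor on the shifts. -/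

import Mathlib

open MeasureTheory Filter Topology
open scoped ENNReal Pointwise symmDiff

namespace NilpotentErgodic

/-! ### Polynomial mappings between groups -/

section Polynomial

variable {Γ G : Type*} [Group Γ] [Group G]

/-- The derivative `D_{a,b} g (n) = g(n)⁻¹ g(a n b)`. -/
def discreteDeriv (a b : Γ) (g : Γ → G) : Γ → G := fun n => (g n)⁻¹ * g (a * n * b)

/-- `g` is polynomial of scalar degree at most `d`: all iterated derivatives
`D_{a₁,b₁} ⋯ D_{a_{d+1},b_{d+1}} g` of order `d + 1` are identically `1`. -/
def IsPolynomialOfScalarDegreeLE (d : ℕ) (g : Γ → G) : Prop :=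
  ∀ s : List (Γ × Γ), s.length = d + 1 →
    ∀ n : Γ, s.foldr (fun p h => discreteDeriv p.1 p.2 h) g n = 1

/-- `g` is a polynomial mapping: it has some finite scalar degree. -/
def IsPolynomialMap (g : Γ → G) : Prop := ∃ d : ℕ, IsPolynomialOfScalarDegreeLE d g

end Polynomial

/-! ### Følner nets -/

/-- A net `F` of compact sets of positive measure (in particular, nonempty sets) is a Følner net
for the left Haar measure `ν` if `sup_{l ∈ K} ν (l F_α ∆ F_α) / ν (F_α) → 0` for every
compact set `K`. -/
structure IsFolnerNet {Γ : Type*} [Group Γ] [TopologicalSpace Γ] [MeasurableSpace Γ]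
    (ν : Measure Γ) {A : Type*} [Preorder A] (F : A → Set Γ) : Prop where
  isCompact : ∀ α, IsCompact (F α)
  measure_pos : ∀ α, 0 < ν (F α)
  tendsto_sup : ∀ K : Set Γ, IsCompact K →
    Tendsto (fun α => ⨆ l ∈ K, ν ((l • F α) ∆ F α) / ν (F α)) atTop (𝓝 0)

/-! ### Unitary operators acting by algebra homomorphisms on bounded functions -/

section Operators

variable {𝕜 Ω : Type*} [RCLike 𝕜] [MeasurableSpace Ω] {μ : Measure Ω}

/-- The inclusion of `L^∞` into `L²` for a finite measure. -/
noncomputable def toL2 [IsFiniteMeasure μ] (f : Lp 𝕜 ∞ μ) : Lp 𝕜 2 μ :=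
  ⟨(f : Ω →ₘ[μ] 𝕜), Lp.antitone le_top f.2⟩

/-- The unitary operator `U` on `L²` acts as an isometric algebra homomorphism on `L^∞`:
it preserves the `L^∞` norm of bounded functions (so it maps `L^∞` to itself) and is
multiplicative on bounded functions. Linearity is part of the type of `U`. -/
structure ActsOnLInfty (U : Lp 𝕜 2 μ ≃ₗᵢ[𝕜] Lp 𝕜 2 μ) : Prop where
  isometric : ∀ f : Lp 𝕜 2 μ, MemLp f ∞ μ → eLpNorm (U f) ∞ μ = eLpNorm f ∞ μ
  map_mul : ∀ f₁ f₂ f : Lp 𝕜 2 μ, MemLp f₁ ∞ μ → MemLp f₂ ∞ μ →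
    (f : Ω →ₘ[μ] 𝕜) = (f₁ : Ω →ₘ[μ] 𝕜) * (f₂ : Ω →ₘ[μ] 𝕜) →
    (U f : Ω →ₘ[μ] 𝕜) = (U f₁ : Ω →ₘ[μ] 𝕜) * (U f₂ : Ω →ₘ[μ] 𝕜)

theorem mul_mem_LInfty {f g : Ω →ₘ[μ] 𝕜} (hf : f ∈ Lp 𝕜 ∞ μ) (hg : g ∈ Lp 𝕜 ∞ μ) :
    f * g ∈ Lp 𝕜 ∞ μ := by
  rw [Lp.mem_Lp_iff_memLp] at *
  exact (memLp_congr_ae (AEEqFun.coeFn_mul f g)).2 (hg.mul (r := ∞) hf)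

theorem one_mem_LInfty : (1 : Ω →ₘ[μ] 𝕜) ∈ Lp 𝕜 ∞ μ := by
  rw [Lp.mem_Lp_iff_memLp]
  exact (memLp_congr_ae AEEqFun.coeFn_one).2 (memLp_top_const (1 : 𝕜))

theorem prod_mem_LInfty {ι : Type*} (s : Finset ι) (f : ι → Ω →ₘ[μ] 𝕜)
    (hf : ∀ i ∈ s, f i ∈ Lp 𝕜 ∞ μ) : ∏ i ∈ s, f i ∈ Lp 𝕜 ∞ μ :=
  Finset.prod_induction f (· ∈ Lp 𝕜 ∞ μ) (fun _ _ => mul_mem_LInfty) one_mem_LInfty hf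

theorem ActsOnLInfty.apply_mem [IsFiniteMeasure μ] {U : Lp 𝕜 2 μ ≃ₗᵢ[𝕜] Lp 𝕜 2 μ}
    (hU : ActsOnLInfty U) (f : Lp 𝕜 ∞ μ) : (U (toL2 f) : Ω →ₘ[μ] 𝕜) ∈ Lp 𝕜 ∞ μ := by
  have h := hU.isometric (toL2 f) (Lp.memLp f)
  rw [Lp.mem_Lp_iff_eLpNorm_lt_top, h]
  exact Lp.eLpNorm_lt_top f

/-- The function `f₀ · U₁ f₁ ⋯ U_j f_j` as an element of `L²`. -/
noncomputable def multipleProduct [IsFiniteMeasure μ] {G : Subgroup (Lp 𝕜 2 μ ≃ₗᵢ[𝕜] Lp 𝕜 2 μ)}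
    (hG : ∀ U ∈ G, ActsOnLInfty U) {j : ℕ} (f₀ : Lp 𝕜 ∞ μ) (f : Fin j → Lp 𝕜 ∞ μ)
    (U : Fin j → G) : Lp 𝕜 2 μ :=
  toL2 ⟨(f₀ : Ω →ₘ[μ] 𝕜) *
      ∏ i, ((U i : Lp 𝕜 2 μ ≃ₗᵢ[𝕜] Lp 𝕜 2 μ) (toL2 (f i)) : Ω →ₘ[μ] 𝕜),
    mul_mem_LInfty f₀.2
      (prod_mem_LInfty _ _ fun i _ => (hG _ (U i).2).apply_mem (f i))⟩

/-- Measurability of a mapping `g` from `Γ` into a group `G` of unitary operators with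
the strong operator topology. It is measurability with respect to the Haar measure `ν`, in the
sense of Bochner: for every `f ∈ L²` the mappings `n ↦ g(n) f` and `n ↦ g(n)⁻¹ f` agree, almost
everywhere on each compact set, with a limit of measurable simple functions. (If `L²` is
separable, it suffices to ask this of `n ↦ g(n) f`.) -/
def IsMeasurableMap {Γ : Type*} [TopologicalSpace Γ] [MeasurableSpace Γ] (ν : Measure Γ)
    {G : Subgroup (Lp 𝕜 2 μ ≃ₗᵢ[𝕜] Lp 𝕜 2 μ)} (g : Γ → G) : Prop :=
  ∀ f : Lp 𝕜 2 μ, ∀ K : Set Γ, IsCompact K →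
    AEStronglyMeasurable (fun n => (g n : Lp 𝕜 2 μ ≃ₗᵢ[𝕜] Lp 𝕜 2 μ) f) (ν.restrict K) ∧
    AEStronglyMeasurable (fun n => ((g n)⁻¹ : Lp 𝕜 2 μ ≃ₗᵢ[𝕜] Lp 𝕜 2 μ) f) (ν.restrict K)

end Operators

end NilpotentErgodic

namespace NilpotentErgodic

set_option linter.unusedSectionVars false

/-! ### Polynomial elements with respect to a filtration -/

section Filtration

/-! If `M_f` is multiplication by a bounded function, then `ρ(g) M_f ρ(g)⁻¹` is multiplication by `g
f`. The multiple product is therefore a product of conjugated multipliers applied to the constant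
function 1, and convergence can be studied for families of commuting contractions
(`MultiplierSystem`).

Fix a finite system consisting of `g` and a set `S` of other mappings. The average at scale `k` is
`T_k u`, where `T_k` averages the contractions `W(n)` = (product over `S`) · `ρ(g(n))` and `u` lies
in the unit ball of `L^∞`. Approximate `u` in `L²` almost optimally by vectors whose averages are
Cauchy. If the remainder `w` still has a large average at some large scale `n`, then `T_n* T_n w`
correlates with `w`, and subtracting a small multiple of it improves the approximation, which is
impossible (`cauchyFam_of_structured`). It remains to treat the structured vectors `σ = T_n* h`.
When `F_n` is almost invariant under `a_k F_k`, the vector `T_k σ` is, weakly, a mean over `m` of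
averages of `W(n') W*(b n' m) h` (`inner_avgOp_avgOp`). In these averages `g` enters only through
the reductions `⟨g|h'⟩ = g (τg)⁻¹ τh'`, where `τ` is a two-sided translation and `h'` lies in `S ∪
{1}`. So the claim for `S ∪ {g}` follows from the claim for all the systems `S ∪ ⟨g | S ∪ {1}⟩`;
this is `IsReducible`.

The induction terminates because polynomial mappings into a nilpotent group form a group, filtered
by normal subgroups whose levels are raised by derivatives (`polyClosed`). Reducing by a polynomial
element preserves the cosets of the next level, so cosets can be removed one at a time, level by
level, until only the trivial group is left (`IsReducible.coset`).

Since `τ` depends on scales and on `m`, convergence must be uniform in the system and in the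
multipliers. Uniformity is encoded by letting all data depend on an index `x` and asking for
estimates for almost all `x` along a nonprincipal ultrafilter on `ℕ`. A single parameter `m` that is
bad for infinitely many pairs of scales is extracted by a limsup argument (`exists_frequently_mem`).

Finally, a function of shifted averaging sets that is Cauchy along all sequences of increasingly
invariant sets converges along the filter of almost invariant sets. Every Følner net with arbitrary
shifts tends to that filter. -/

theorem commutator_lowerCentralSeries_le (G : Type*) [Group G] (m n : ℕ) :
    ⁅(⊤ : Subgroup G).lowerCentralSeries m, (⊤ : Subgroup G).lowerCentralSeries n⁆ ≤
      (⊤ : Subgroup G).lowerCentralSeries (m + n + 1) := by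
  induction n generalizing m with
  | zero => exact le_rfl
  | succ n ih =>
    set N := (⊤ : Subgroup G).lowerCentralSeries (m + (n + 1) + 1) with hN
    have key : ∀ A : Subgroup G, A ≤ N ↔ A.map (QuotientGroup.mk' N) = ⊥ := fun A => by
      rw [Subgroup.map_eq_bot_iff, QuotientGroup.ker_mk']
    rw [Subgroup.commutator_comm, Subgroup.lowerCentralSeries_succ, key, Subgroup.map_commutator,
      Subgroup.map_commutator]
    -- Three subgroups lemma in the quotient by `N`: the two rotated double commutators are
    -- controlled by the induction hypothesis at `m + 1` and at `m`.
    apply Subgroup.commutator_commutator_eq_bot_of_rotate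
    · rw [← Subgroup.map_commutator, ← Subgroup.map_commutator, ← key, Subgroup.commutator_comm ⊤]
      refine (ih (m + 1)).trans (le_of_eq ?_)
      rw [hN]; congr 1; omega
    · rw [← Subgroup.map_commutator, ← Subgroup.map_commutator, ← key]
      exact (Subgroup.commutator_mono (ih m) le_rfl).trans (le_of_eq rfl)

variable {𝔾 : Type*} [Group 𝔾]

/-- The commutator `x⁻¹ y⁻¹ x y`. -/
def rightComm (x y : 𝔾) : 𝔾 := x⁻¹ * y⁻¹ * x * y

/-- The iterated derivative of an element along a list of endomorphisms. -/
def iterDeriv (s : List (Monoid.End 𝔾)) (g : 𝔾) : 𝔾 := s.foldr (fun τ h => h⁻¹ * τ h) g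

/-- An element is polynomial of level `t` if its derivatives of order `i` lie in `L (t + i)`. -/
def IsPoly (𝒯 : Set (Monoid.End 𝔾)) (L : ℕ → Subgroup 𝔾) (t : ℕ) (g : 𝔾) : Prop :=
  ∀ s : List (Monoid.End 𝔾), (∀ τ ∈ s, τ ∈ 𝒯) → iterDeriv s g ∈ L (t + s.length)

variable {𝒯 : Set (Monoid.End 𝔾)} {L L' : ℕ → Subgroup 𝔾} {t : ℕ} {g h : 𝔾}

/-- The last entry of the list is the first derivative taken, so appending an entry replaces `g` by
a derivative and raises the level by one. -/
theorem isPoly_iff : IsPoly 𝒯 L t g ↔ g ∈ L t ∧ ∀ τ ∈ 𝒯, IsPoly 𝒯 L (t + 1) (g⁻¹ * τ g) := by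
  constructor
  · refine fun H => ⟨by simpa [iterDeriv] using H [] (by simp), fun τ hτ s hs => ?_⟩
    have := H (s ++ [τ]) (by simpa [or_imp, forall_and] using ⟨hs, hτ⟩)
    simpa [iterDeriv, add_assoc, add_comm 1] using this
  · rintro ⟨h0, h1⟩ s hs
    rcases List.eq_nil_or_concat s with rfl | ⟨s', τ, rfl⟩
    · simpa [iterDeriv] using h0
    · simp only [List.concat_eq_append, List.mem_append, List.mem_singleton] at hs
      have := h1 τ (hs τ (by simp)) s' (fun σ hσ => hs σ (Or.inl hσ))
      simpa [iterDeriv, add_assoc, add_comm 1] using this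

theorem IsPoly.mem (H : IsPoly 𝒯 L t g) : g ∈ L t := (isPoly_iff.1 H).1

theorem IsPoly.deriv (H : IsPoly 𝒯 L t g) {τ : Monoid.End 𝔾} (hτ : τ ∈ 𝒯) :
    IsPoly 𝒯 L (t + 1) (g⁻¹ * τ g) := (isPoly_iff.1 H).2 τ hτ

theorem IsPoly.mono_level (hL : Antitone L) {t' : ℕ} (H : IsPoly 𝒯 L t' g) (h : t ≤ t') :
    IsPoly 𝒯 L t g := fun s hs => hL (by omega) (H s hs)

theorem IsPoly.mono (hL : ∀ i, L' i ≤ L i) (H : IsPoly 𝒯 L' t g) : IsPoly 𝒯 L t g :=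
  fun s hs => hL _ (H s hs)

theorem isPoly_of_forall_mem {N : Subgroup 𝔾} (hN : ∀ τ ∈ 𝒯, ∀ x ∈ N, τ x ∈ N)
    (hL : ∀ i, t ≤ i → N ≤ L i) (hg : g ∈ N) : IsPoly 𝒯 L t g := by
  intro s hs
  refine hL _ (by omega) ?_
  induction s with
  | nil => exact hg
  | cons τ s ih =>
    have := ih (fun σ hσ => hs σ (List.mem_cons_of_mem _ hσ))
    exact N.mul_mem (N.inv_mem this) (hN τ (hs τ (by simp)) _ this)

/-- A filtration of a group by subgroups invariant under a set of endomorphisms. -/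
structure IsFiltration (𝒯 : Set (Monoid.End 𝔾)) (K : ℕ → Subgroup 𝔾) : Prop where
  anti : Antitone K
  one : K 1 = ⊤
  comm : ∀ i j, ∀ x ∈ K i, ∀ y ∈ K j, rightComm x y ∈ K (i + j)
  inv : ∀ τ ∈ 𝒯, ∀ i, ∀ x ∈ K i, τ x ∈ K i

/-- The filtration `K`, made constant from the index `e` on. -/
def truncFiltration (K : ℕ → Subgroup 𝔾) (e i : ℕ) : Subgroup 𝔾 := K (min i e)

variable {K : ℕ → Subgroup 𝔾}

theorem IsFiltration.truncAnti (hK : IsFiltration 𝒯 K) (e : ℕ) :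
    Antitone (truncFiltration K e) :=
  fun i j h => hK.anti (by simp only [le_min_iff]; omega)

theorem IsFiltration.truncSucc (hK : IsFiltration 𝒯 K) (e i : ℕ) :
    truncFiltration K (e + 1) i ≤ truncFiltration K e i := hK.anti (by omega)

/-- As `K 0 = K 1 = ⊤`, both indices may be taken to be at least 1. When one of them has reached the
cutoff `e`, the other still contributes 1, which is why the cutoff improves to `e + 1`. -/
theorem IsFiltration.comm_trunc (hK : IsFiltration 𝒯 K) {e t s : ℕ}
    (hg : g ∈ truncFiltration K e t) (hh : h ∈ truncFiltration K e s) :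
    rightComm g h ∈ truncFiltration K (e + 1) (t + s) := by
  have aux : ∀ (i : ℕ) (x : 𝔾), x ∈ K i → x ∈ K (max 1 i) := by
    intro i x hx
    rcases Nat.eq_zero_or_pos i with rfl | hi
    · simp [hK.one]
    · rwa [max_eq_right hi]
  exact hK.anti (by omega) (hK.comm _ _ _ (aux _ _ hg) _ (aux _ _ hh))

/-- Closure of polynomial elements of level at least `t` under the group operations. -/
def PolyClosed (𝒯 : Set (Monoid.End 𝔾)) (L : ℕ → Subgroup 𝔾) (t : ℕ) : Prop :=
  (∀ g h, IsPoly 𝒯 L t g → IsPoly 𝒯 L t h → IsPoly 𝒯 L t (g * h)) ∧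
    ∀ g, IsPoly 𝒯 L t g → IsPoly 𝒯 L t g⁻¹

theorem polyClosed_of_const {N : Subgroup 𝔾} (hN : ∀ τ ∈ 𝒯, ∀ x ∈ N, τ x ∈ N)
    (hL : ∀ i, t ≤ i → L i = N) : PolyClosed 𝒯 L t := by
  have h : ∀ g, IsPoly 𝒯 L t g ↔ g ∈ N := fun g =>
    ⟨fun H => hL t le_rfl ▸ H.mem, isPoly_of_forall_mem hN fun i hi => (hL i hi).ge⟩
  simp only [PolyClosed, h]
  exact ⟨fun _ _ => N.mul_mem, fun _ => N.inv_mem⟩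

theorem deriv_mul (τ : Monoid.End 𝔾) (g h : 𝔾) : (g * h)⁻¹ * τ (g * h) =
    (g⁻¹ * τ g) * rightComm (g⁻¹ * τ g) h * (h⁻¹ * τ h) := by
  simp only [rightComm, map_mul]; group

theorem deriv_inv (τ : Monoid.End 𝔾) (g : 𝔾) : (g⁻¹)⁻¹ * τ (g⁻¹) =
    (g⁻¹ * τ g)⁻¹ * rightComm (g⁻¹ * τ g)⁻¹ g⁻¹ := by
  simp only [rightComm, map_inv]; group

/-- Every factor on the right is a commutator whose entries have total level above that of
`rightComm g h`; this is what makes a downward induction on the level possible. -/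
theorem deriv_rightComm (τ : Monoid.End 𝔾) (g h : 𝔾) :
    let u := g⁻¹ * τ g
    let v := h⁻¹ * τ h
    let w := rightComm g h
    let X := rightComm g v * w * rightComm w v
    w⁻¹ * τ w = rightComm g v * rightComm (rightComm g v) w * rightComm w v * rightComm X u *
      (rightComm u v * rightComm u h * rightComm (rightComm u h) v) := by
  simp only [rightComm, map_inv, map_mul]; group

/-- Downward induction on the level `N`, with `n` bounding the distance to `e + 1`, where the
truncated filtration becomes constant and both claims are trivial. The commutator claim takes its
inputs in the weaker truncation at `e` and gains one in the cutoff. It then supplies the correction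
terms `rightComm` in the derivatives of products and inverses. -/
theorem polyClosed_step (hK : IsFiltration 𝒯 K) (e : ℕ)
    (hM : ∀ t, PolyClosed 𝒯 (truncFiltration K e) t)
    (hW : ∀ t s g h, IsPoly 𝒯 (truncFiltration K e) t g → IsPoly 𝒯 (truncFiltration K e) s h →
      IsPoly 𝒯 (truncFiltration K e) (t + s) (rightComm g h)) (n N : ℕ) (hN : e + 1 ≤ N + n) :
    (∀ t s, N ≤ t + s → ∀ g h, IsPoly 𝒯 (truncFiltration K e) t g →
      IsPoly 𝒯 (truncFiltration K e) s h →
      IsPoly 𝒯 (truncFiltration K (e + 1)) (t + s) (rightComm g h)) ∧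
    ∀ t, N ≤ t → PolyClosed 𝒯 (truncFiltration K (e + 1)) t := by
  have anti := hK.truncAnti e
  have anti' := hK.truncAnti (e + 1)
  induction n generalizing N with
  | zero =>
    have hc : ∀ i, N ≤ i → truncFiltration K (e + 1) i = K (e + 1) := fun i hi => by
      rw [truncFiltration, min_eq_right (by omega)]
    refine ⟨fun t s hts g h hg hh => ?_, fun t ht =>
      polyClosed_of_const (fun τ hτ => hK.inv τ hτ (e + 1)) fun i hi => hc i (by omega)⟩
    refine isPoly_of_forall_mem (fun τ hτ => hK.inv τ hτ (e + 1))
      (fun i hi => (hc i (by omega)).ge) ?_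
    rw [← hc _ hts]
    exact hK.comm_trunc hg.mem hh.mem
  | succ n ih =>
    obtain ⟨ihS, ihM⟩ := ih (N + 1) (by omega)
    have low : ∀ {t g}, IsPoly 𝒯 (truncFiltration K (e + 1)) t g →
        IsPoly 𝒯 (truncFiltration K e) t g := fun H => H.mono (hK.truncSucc e)
    constructor
    · intro t s hts g h hg hh
      rcases Nat.lt_or_ge N (t + s) with hlt | hge
      · exact ihS t s hlt g h hg hh
      obtain rfl : N = t + s := le_antisymm hts hge
      refine isPoly_iff.2 ⟨hK.comm_trunc hg.mem hh.mem, fun τ hτ => ?_⟩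
      have hu := hg.deriv hτ
      have hv := hh.deriv hτ
      have hw := hW t s g h hg hh
      rw [deriv_rightComm]
      set u := g⁻¹ * τ g
      set v := h⁻¹ * τ h
      set w := rightComm g h
      have mem : ∀ {i x}, IsPoly 𝒯 (truncFiltration K (e + 1)) i x → t + s + 1 ≤ i →
        IsPoly 𝒯 (truncFiltration K (e + 1)) (t + s + 1) x := fun H hi => H.mono_level anti' hi
      have mul := (ihM (t + s + 1) le_rfl).1
      have hgv := ihS t (s + 1) (by omega) g v hg hv
      have hwv := ihS (t + s) (s + 1) (by omega) w v hw hv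
      have huh := ihS (t + 1) s (by omega) u h hu hh
      -- `X` has the same level `t + s` as `w`, which is not yet accessible in the truncation at `e
      -- + 1`. The closure known at `e` suffices, because `X` is only used inside a commutator with
      -- `u`.
      have hX : IsPoly 𝒯 (truncFiltration K e) (t + s)
          (rightComm g v * w * rightComm w v) := by
        refine (hM _).1 _ _ ((hM _).1 _ _ ?_ hw) ?_
        · exact (low hgv).mono_level anti (by omega)
        · exact (low hwv).mono_level anti (by omega)
      refine mul _ _ (mul _ _ (mul _ _ (mul _ _ ?_ ?_) ?_) ?_) (mul _ _ (mul _ _ ?_ ?_) ?_)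
      · exact mem hgv (by omega)
      · exact mem (ihS _ _ (by omega) _ _ (low hgv) hw) (by omega)
      · exact mem hwv (by omega)
      · exact mem (ihS _ _ (by omega) _ _ hX hu) (by omega)
      · exact mem (ihS _ _ (by omega) _ _ hu hv) (by omega)
      · exact mem huh (by omega)
      · exact mem (ihS _ _ (by omega) _ _ (low huh) hv) (by omega)
    · intro t ht
      rcases Nat.lt_or_ge N t with hlt | hge
      · exact ihM t hlt
      obtain rfl : N = t := le_antisymm ht hge
      obtain ⟨mul, inv⟩ := ihM (N + 1) le_rfl
      refine ⟨fun g h hg hh => isPoly_iff.2 ⟨Subgroup.mul_mem _ hg.mem hh.mem, fun τ hτ => ?_⟩,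
        fun g hg => isPoly_iff.2 ⟨Subgroup.inv_mem _ hg.mem, fun τ hτ => ?_⟩⟩
      · rw [deriv_mul]
        refine mul _ _ (mul _ _ (hg.deriv hτ) ?_) (hh.deriv hτ)
        exact (ihS _ _ (by omega) _ _ (low (hg.deriv hτ)) (low hh)).mono_level anti' (by omega)
      · rw [deriv_inv]
        have := inv _ (hg.deriv hτ)
        refine mul _ _ this ?_
        exact (ihS _ _ (by omega) _ _ (low this) ((hM _).2 _ (low hg))).mono_level anti' (by omega)

theorem polyClosed_trunc (hK : IsFiltration 𝒯 K) (e : ℕ) :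
    (∀ t, PolyClosed 𝒯 (truncFiltration K e) t) ∧
    ∀ t s g h, IsPoly 𝒯 (truncFiltration K e) t g → IsPoly 𝒯 (truncFiltration K e) s h →
      IsPoly 𝒯 (truncFiltration K e) (t + s) (rightComm g h) := by
  induction e with
  | zero =>
    have h0 : ∀ i, truncFiltration K 0 i = ⊤ := fun i => by
      rw [truncFiltration, Nat.min_zero, eq_top_iff, ← hK.one]
      exact hK.anti (by omega)
    exact ⟨fun t => polyClosed_of_const (N := ⊤) (by simp) fun i _ => h0 i,
      fun t s g h _ _ => isPoly_of_forall_mem (N := ⊤) (by simp) (fun i _ => (h0 i).ge) (by simp)⟩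
  | succ e ih =>
    have := polyClosed_step hK e ih.1 ih.2 (e + 1) 0 (by omega)
    refine ⟨fun t => this.2 t (by omega), fun t s g h hg hh => this.1 t s (by omega) g h ?_ ?_⟩
    · exact hg.mono (hK.truncSucc e)
    · exact hh.mono (hK.truncSucc e)

theorem polyClosed (hK : IsFiltration 𝒯 K) {e : ℕ} (he : K e = ⊥) :
    (∀ t, PolyClosed 𝒯 K t) ∧
    ∀ t s g h, IsPoly 𝒯 K t g → IsPoly 𝒯 K s h → IsPoly 𝒯 K (t + s) (rightComm g h) := by
  have : truncFiltration K e = K := by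
    funext i
    rcases le_total i e with h | h
    · rw [truncFiltration, min_eq_left h]
    · rw [truncFiltration, min_eq_right h, he]
      exact (le_bot_iff.1 (he ▸ hK.anti h)).symm
  simpa only [this] using polyClosed_trunc hK e

/-- The subgroup of polynomial elements of level `t`. -/
def polySubgroup (hK : IsFiltration 𝒯 K) {e : ℕ} (he : K e = ⊥) (t : ℕ) : Subgroup 𝔾 where
  carrier := {g | IsPoly 𝒯 K t g}
  mul_mem' ha hb := ((polyClosed hK he).1 t).1 _ _ ha hb
  one_mem' := isPoly_of_forall_mem (N := ⊥) (by simp) (fun _ _ => bot_le) (by simp)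
  inv_mem' ha := ((polyClosed hK he).1 t).2 _ ha

end Filtration

/-! ### Polynomial exhaustion -/

section Exhaustion

variable {𝔾 : Type*} [Group 𝔾]

/-- The reduction `⟨g | h⟩ = g (τ g)⁻¹ τ h`. -/
def reduction (τ : Monoid.End 𝔾) (g h : 𝔾) : 𝔾 := g * (τ g)⁻¹ * τ h

/-- A descending sequence of normal subgroups such that derivatives of elements of each subgroup
lie in the next one. -/
structure IsPolyFiltration (𝒯 : Set (Monoid.End 𝔾)) (P : ℕ → Subgroup 𝔾) : Prop where
  anti : Antitone P
  normal : ∀ t, ∀ p ∈ P t, ∀ g ∈ P 0, g⁻¹ * p * g ∈ P t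
  deriv : ∀ τ ∈ 𝒯, ∀ t, ∀ k ∈ P t, k⁻¹ * τ k ∈ P (t + 1)

variable {𝒯 : Set (Monoid.End 𝔾)} {P : ℕ → Subgroup 𝔾}

/-- A property of sets of elements that is inherited from all reductions. -/
structure IsReducible (𝒯 : Set (Monoid.End 𝔾)) (C : Set 𝔾 → Prop) : Prop where
  mono : ∀ S T, S ⊆ insert 1 T → C T → C S
  base : C ∅
  step : ∀ g S, (∀ τ ∈ 𝒯, C (S ∪ reduction τ g '' insert 1 S)) → C (insert g S)

/-- The element equals `y⁻¹ p (τ p)⁻¹ y · y⁻¹ τ y · τ e`: a conjugate of an inverse derivative, a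
derivative, and an element of `P (t + 1)`. Thus reducing by `p` keeps `y e` in its coset `y P (t +
1)`. -/
theorem IsPolyFiltration.reduction_mem (hP : IsPolyFiltration 𝒯 P) {τ : Monoid.End 𝔾} (hτ : τ ∈ 𝒯)
    {t : ℕ} {p y e : 𝔾} (hp : p ∈ P t) (hy : y ∈ P t) (he : e ∈ P (t + 1)) :
    y⁻¹ * reduction τ p (y * e) ∈ P (t + 1) := by
  have h0 : ∀ {i x}, x ∈ P i → x ∈ P 0 := fun hx => hP.anti (Nat.zero_le _) hx
  have h1 := hP.normal _ _ (inv_mem (hP.deriv τ hτ t p hp)) _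
    (mul_mem (inv_mem (h0 hp)) (h0 hy))
  have h2 := hP.deriv τ hτ t y hy
  have h3 : τ e ∈ P (t + 1) := by
    have := mul_mem he (hP.anti (Nat.le_succ _) (hP.deriv τ hτ _ e he))
    simpa using this
  have := mul_mem (mul_mem h1 h2) h3
  convert! this using 1
  simp only [reduction, map_mul]
  group

/-- The set `g Y E ∪ R`. -/
def cosetUnion (g : 𝔾) (Y E R : Set 𝔾) : Set 𝔾 := (fun p : 𝔾 × 𝔾 => g * p.1 * p.2) '' (Y ×ˢ E) ∪ R

/-- Downward induction on the level `t`. The sets in `𝓡` serve as remainders. By `closed`, reducing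
one by an element of `g P s` produces, up to enlarging the remainder, only new elements of `g P (s +
1)`; by `conv`, adding the single element `g` is harmless. -/
theorem IsReducible.coset (hP : IsPolyFiltration 𝒯 P) {C : Set 𝔾 → Prop} (hC : IsReducible 𝒯 C)
    {n : ℕ} (hn : P n = ⊥) (m t : ℕ) (hmt : n ≤ t + m) (g : 𝔾) (𝓡 : Set (Set 𝔾))
    (one : ∀ R ∈ 𝓡, (1 : 𝔾) ∈ R)
    (closed : ∀ s, t ≤ s → ∀ k ∈ P s, ∀ τ ∈ 𝒯, ∀ R ∈ 𝓡, ∃ E : Set 𝔾, E.Finite ∧ E ⊆ P (s + 1) ∧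
      ∃ R' ∈ 𝓡, R ∪ reduction τ (g * k) '' R ⊆ (fun x => g * x) '' E ∪ R')
    (conv : ∀ R ∈ 𝓡, C (insert g R)) (K : Set 𝔾) (hKf : K.Finite) (hK : K ⊆ P t)
    (R : Set 𝔾) (hR : R ∈ 𝓡) : C ((fun x => g * x) '' K ∪ R) := by
  induction m generalizing t g 𝓡 K R with
  | zero =>
    refine hC.mono _ _ ?_ (conv R hR)
    rintro x (⟨k, hk, rfl⟩ | hx)
    · have : k ∈ P n := hP.anti (by omega) (hK hk)
      rw [hn, Subgroup.mem_bot] at this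
      simp [this]
    · exact Or.inr (Or.inr hx)
  | succ m ih =>
    -- `Y` lists representatives of the cosets of `P (t + 1)` that occur. These are removed one at a
    -- time, while the finite set `E` of offsets inside the cosets may grow arbitrarily.
    have key : ∀ Y : Set 𝔾, Y.Finite → Y ⊆ P t → ∀ E : Set 𝔾, E.Finite → E ⊆ P (t + 1) →
        ∀ R ∈ 𝓡, C (cosetUnion g (insert 1 Y) E R) := by
      intro Y hY
      induction Y, hY using Set.Finite.induction_on with
      | empty =>
        intro _ E hE hEP R hR
        refine hC.mono _ _ ?_ (ih (t + 1) (by omega) g 𝓡 one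
          (fun s hs => closed s (by omega)) conv E hE hEP R hR)
        rintro x (⟨⟨y, e⟩, ⟨hy, he⟩, rfl⟩ | hx)
        · obtain rfl : y = 1 := by simpa using hy
          exact Or.inr (Or.inl ⟨e, he, by simp⟩)
        · exact Or.inr (Or.inr hx)
      | @insert c Y _ hYf ihY =>
        intro hcY E hE hEP R hR
        have hc : c ∈ P t := hcY (Set.mem_insert _ _)
        have hY : insert 1 Y ⊆ P t :=
          Set.insert_subset (one_mem _) ((Set.subset_insert _ _).trans hcY)
        specialize ihY ((Set.subset_insert _ _).trans hcY)
        -- Since `⟨g k | g y e⟩ = g ⟨k | y e⟩`, reduction by `g k` stays within the cosets `g y P (t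
        -- + 1)`: no new representative is needed, only new offsets and a new remainder.
        have absorb : ∀ k ∈ P t, ∀ τ ∈ 𝒯, ∀ E : Set 𝔾, E.Finite → E ⊆ P (t + 1) → ∀ R ∈ 𝓡,
            ∃ E' : Set 𝔾, E'.Finite ∧ E' ⊆ P (t + 1) ∧ ∃ R' ∈ 𝓡,
              cosetUnion g (insert 1 Y) E R ∪
                reduction τ (g * k) '' cosetUnion g (insert 1 Y) E R ⊆
              cosetUnion g (insert 1 Y) E' R' := by
          intro k hk τ hτ E hE hEP R hR
          obtain ⟨E₁, hE₁, hE₁P, R₁, hR₁, hsub⟩ := closed t le_rfl k hk τ hτ R hR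
          have hsub' : R ∪ reduction τ (g * k) '' R ⊆ cosetUnion g (insert 1 Y) E₁ R₁ := by
            intro x hx
            rcases hsub hx with ⟨e, he, rfl⟩ | hx
            · exact Or.inl ⟨(1, e), ⟨Set.mem_insert _ _, he⟩, by simp⟩
            · exact Or.inr hx
          have mono : ∀ {A B : Set 𝔾}, A ⊆ B → cosetUnion g (insert 1 Y) A R₁ ⊆
              cosetUnion g (insert 1 Y) B R₁ := fun hAB =>
            Set.union_subset_union_left _ (Set.image_mono (Set.prod_mono_right hAB))
          refine ⟨E ∪ E₁ ∪ (fun p : 𝔾 × 𝔾 => p.1⁻¹ * reduction τ k (p.1 * p.2)) ''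
            (insert 1 Y ×ˢ E), ?_, ?_, R₁, hR₁, ?_⟩
          · exact (hE.union hE₁).union (((hYf.insert 1).prod hE).image _)
          · rintro x ((hx | hx) | ⟨⟨y, e⟩, ⟨hy, he⟩, rfl⟩)
            · exact hEP hx
            · exact hE₁P hx
            · exact hP.reduction_mem hτ hk (hY hy) (hEP he)
          · have hR₁' : R ∪ reduction τ (g * k) '' R ⊆ cosetUnion g (insert 1 Y) (E ∪ E₁ ∪
              (fun p : 𝔾 × 𝔾 => p.1⁻¹ * reduction τ k (p.1 * p.2)) '' (insert 1 Y ×ˢ E)) R₁ :=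
              hsub'.trans (mono fun x hx => Or.inl (Or.inr hx))
            rintro x ((⟨⟨y, e⟩, hye, rfl⟩ | hx) | ⟨_, (⟨⟨y, e⟩, hye, rfl⟩ | hx), rfl⟩)
            · exact Or.inl ⟨(y, e), ⟨hye.1, Or.inl (Or.inl hye.2)⟩, rfl⟩
            · exact hR₁' (Or.inl hx)
            · refine Or.inl ⟨(y, y⁻¹ * reduction τ k (y * e)),
                ⟨hye.1, Or.inr ⟨(y, e), hye, rfl⟩⟩, ?_⟩
              simp only [reduction, map_mul]; group
            · exact hR₁' (Or.inr ⟨_, hx, rfl⟩)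
        have one' : ∀ E, ∀ R ∈ 𝓡, (1 : 𝔾) ∈ cosetUnion g (insert 1 Y) E R :=
          fun E R hR => Or.inr (one R hR)
        -- The coset of `g c` becomes the new main coset, one level deeper. All sets over the
        -- remaining representatives become the new remainders; reductions by elements of that coset
        -- are absorbed by them, so `closed` holds with empty offset set.
        refine hC.mono _ _ ?_ (ih (t + 1) (by omega) (g * c)
          {R' | ∃ E : Set 𝔾, E.Finite ∧ E ⊆ P (t + 1) ∧ ∃ R ∈ 𝓡,
            R' = cosetUnion g (insert 1 Y) E R} ?_ ?_ ?_ E hE hEP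
            (cosetUnion g (insert 1 Y) E R) ⟨E, hE, hEP, R, hR, rfl⟩)
        · rintro x (⟨⟨y, e⟩, ⟨hy, he⟩, rfl⟩ | hx)
          · rcases hy with rfl | rfl | hy
            · exact Or.inr (Or.inr (Or.inl ⟨(1, e), ⟨Or.inl rfl, he⟩, rfl⟩))
            · exact Or.inr (Or.inl ⟨e, he, rfl⟩)
            · exact Or.inr (Or.inr (Or.inl ⟨(y, e), ⟨Or.inr hy, he⟩, rfl⟩))
          · exact Or.inr (Or.inr (Or.inr hx))
        · rintro _ ⟨E, -, -, R, hR, rfl⟩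
          exact one' E R hR
        · rintro s hs k hk τ hτ _ ⟨E, hE, hEP, R, hR, rfl⟩
          obtain ⟨E', hE', hEP', R', hR', hsub⟩ := absorb (c * k)
            (mul_mem hc (hP.anti (by omega) hk)) τ hτ E hE hEP R hR
          refine ⟨∅, Set.finite_empty, Set.empty_subset _, _, ⟨E', hE', hEP', R', hR', rfl⟩, ?_⟩
          rw [mul_assoc]
          exact hsub.trans Set.subset_union_right
        · rintro _ ⟨E, hE, hEP, R, hR, rfl⟩
          refine hC.step _ _ fun τ hτ => ?_
          rw [Set.insert_eq_of_mem (one' E R hR)]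
          obtain ⟨E', hE', hEP', R', hR', hsub⟩ := absorb c hc τ hτ E hE hEP R hR
          exact hC.mono _ _ (hsub.trans (Set.subset_insert _ _)) (ihY E' hE' hEP' R' hR')
    refine hC.mono _ _ ?_ (key K hKf hK {1} (Set.finite_singleton 1) (by simp) R hR)
    rintro x (⟨k, hk, rfl⟩ | hx)
    · exact Or.inr (Or.inl ⟨(k, 1), ⟨Or.inr hk, rfl⟩, by simp⟩)
    · exact Or.inr (Or.inr hx)

/-- A reducible property holds for all finite sets of polynomial elements. -/
theorem IsReducible.of_finite (hP : IsPolyFiltration 𝒯 P) {C : Set 𝔾 → Prop}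
    (hC : IsReducible 𝒯 C) {n : ℕ} (hn : P n = ⊥) {K : Set 𝔾} (hKf : K.Finite) (hK : K ⊆ P 0) :
    C K := by
  refine hC.mono _ _ ?_ (hC.coset hP hn n 0 (by omega) 1 {{1}} (by simp) ?_ ?_ K hKf hK {1} rfl)
  · intro x hx
    exact Or.inr (Or.inl ⟨x, hx, one_mul x⟩)
  · rintro s - k hk τ hτ _ rfl
    refine ⟨{reduction τ k 1}, Set.finite_singleton _, ?_, {1}, rfl, ?_⟩
    · have := hP.reduction_mem hτ hk (one_mem _) (one_mem _)
      simpa using this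
    · rintro x (hx | ⟨y, rfl, rfl⟩)
      · exact Or.inr hx
      · exact Or.inl ⟨_, rfl, by simp⟩
  · rintro _ rfl
    exact hC.mono _ ∅ (by simp) hC.base

end Exhaustion

/-! ### Families of polynomial mappings into nilpotent groups -/

section Families

variable {I Γ G : Type*} [Group G]

/-- Families with values in the terms of the lower central series, each repeated `d` times. -/
def slowCentralSeries (I Γ G : Type*) [Group G] (d i : ℕ) : Subgroup (I → Γ → G) :=
  Subgroup.pi Set.univ fun _ => Subgroup.pi Set.univ fun _ =>
    (⊤ : Subgroup G).lowerCentralSeries ((i - 1) / d)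

theorem mem_slowCentralSeries {d i : ℕ} {g : I → Γ → G} : g ∈ slowCentralSeries I Γ G d i ↔
    ∀ x n, g x n ∈ (⊤ : Subgroup G).lowerCentralSeries ((i - 1) / d) := by
  simp [slowCentralSeries, Subgroup.mem_pi]

variable [Group Γ]

/-- Translation of a family of mappings by families of group elements. -/
def translate (a b : I → Γ) : Monoid.End (I → Γ → G) where
  toFun g x n := g x (a x * n * b x)
  map_one' := rfl
  map_mul' _ _ := rfl

/-- The set of all translations. -/
def translations (I Γ G : Type*) [Group Γ] [Group G] : Set (Monoid.End (I → Γ → G)) :=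
  Set.range fun p : (I → Γ) × (I → Γ) => translate p.1 p.2

theorem isFiltration_slowCentralSeries {d : ℕ} (hd : 0 < d) :
    IsFiltration (translations I Γ G) (slowCentralSeries I Γ G d) where
  anti i j hij g := by
    simp only [mem_slowCentralSeries]
    exact fun h x n => Subgroup.lowerCentralSeries_antitone _
      (Nat.div_le_div_right (Nat.sub_le_sub_right hij 1)) (h x n)
  one := by
    ext g
    simp [mem_slowCentralSeries]
  comm i j g hg h hh := by
    rw [mem_slowCentralSeries] at *
    intro x n
    have key := commutator_lowerCentralSeries_le G _ _
      (Subgroup.commutator_mem_commutator (inv_mem (hg x n)) (inv_mem (hh x n)))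
    rw [commutatorElement_def, inv_inv, inv_inv] at key
    refine Subgroup.lowerCentralSeries_antitone _ ?_ key
    rw [← Nat.lt_succ_iff, Nat.div_lt_iff_lt_mul hd]
    have h1 := Nat.lt_div_mul_add (a := i - 1) hd
    have h2 := Nat.lt_div_mul_add (a := j - 1) hd
    have : ((i - 1) / d + (j - 1) / d + 1).succ * d =
      (i - 1) / d * d + (j - 1) / d * d + 2 * d := by rw [Nat.succ_eq_add_one]; ring
    omega
  inv := by
    rintro _ ⟨p, rfl⟩ i g hg
    rw [mem_slowCentralSeries] at *
    exact fun x n => hg x _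

theorem foldr_discreteDeriv_eq_one {d : ℕ} {g : Γ → G} (hg : IsPolynomialOfScalarDegreeLE d g)
    (s : List (Γ × Γ)) (hs : d + 1 ≤ s.length) (n : Γ) :
    s.foldr (fun p h => discreteDeriv p.1 p.2 h) g n = 1 := by
  induction s generalizing n with
  | nil => simp at hs
  | cons p s ih =>
    rcases Nat.lt_or_ge s.length (d + 1) with h | h
    · exact hg _ (by simp only [List.length_cons] at hs ⊢; omega) n
    · simp [discreteDeriv, ih h]

/-- Derivatives of order at most `d` need only lie in the full group, because the first term is
repeated `d` times, and those of higher order are trivial. -/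
theorem isPoly_slowCentralSeries {d e : ℕ} (hed : e ≤ d) (hd : 0 < d) {g : I → Γ → G}
    (hg : ∀ x, IsPolynomialOfScalarDegreeLE e (g x)) :
    IsPoly (translations I Γ G) (slowCentralSeries I Γ G d) 0 g := by
  intro s hs
  have key : ∀ x, ∃ l : List (Γ × Γ), l.length = s.length ∧
      ∀ n, iterDeriv s g x n = l.foldr (fun p h => discreteDeriv p.1 p.2 h) (g x) n := by
    intro x
    induction s with
    | nil => exact ⟨[], rfl, fun n => rfl⟩
    | cons τ s ih =>
      obtain ⟨l, hl, hl'⟩ := ih fun σ hσ => hs σ (List.mem_cons_of_mem _ hσ)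
      obtain ⟨p, rfl⟩ := hs τ (by simp)
      refine ⟨(p.1 x, p.2 x) :: l, by simp [hl], fun n => ?_⟩
      simp only [List.foldr_cons, discreteDeriv, ← hl']
      rfl
  rw [mem_slowCentralSeries]
  intro x n
  obtain ⟨l, hl, hl'⟩ := key x
  rcases Nat.lt_or_ge d s.length with h | h
  · rw [hl', foldr_discreteDeriv_eq_one (hg x) l (by omega)]
    exact one_mem _
  · rw [Nat.div_eq_of_lt (by omega)]
    exact Subgroup.mem_top _

theorem isPolyFiltration_polySubgroup {𝔾 : Type*} [Group 𝔾] {𝒯 : Set (Monoid.End 𝔾)}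
    {K : ℕ → Subgroup 𝔾} (hK : IsFiltration 𝒯 K) {e : ℕ} (he : K e = ⊥) :
    IsPolyFiltration 𝒯 (polySubgroup hK he) where
  anti _ _ h _ hg := IsPoly.mono_level hK.anti hg h
  normal t p hp g hg := by
    have h : rightComm p g ∈ polySubgroup hK he t := (polyClosed hK he).2 t 0 p g hp hg
    convert! mul_mem hp h using 1
    simp only [rightComm]; group
  deriv _ hτ _ _ hk := IsPoly.deriv hk hτ

/-- A reducible property of sets of families holds for finite sets of polynomial mappings into a
nilpotent group. -/
theorem IsReducible.of_isPolynomialMap [Group.IsNilpotent G] {C : Set (I → Γ → G) → Prop}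
    (hC : IsReducible (translations I Γ G) C) {ι : Type*} [Finite ι] (g : ι → Γ → G)
    (hg : ∀ i, IsPolynomialMap (g i)) : C (Set.range fun i (_ : I) => g i) := by
  choose e he using hg
  cases nonempty_fintype ι
  obtain ⟨d, hd, hed⟩ : ∃ d, 0 < d ∧ ∀ i, e i ≤ d :=
    ⟨(Finset.univ.sup e) + 1, Nat.succ_pos _,
      fun i => (Finset.le_sup (Finset.mem_univ i)).trans (Nat.le_succ _)⟩
  obtain ⟨c, hc⟩ := Subgroup.nilpotent_iff_lowerCentralSeries.1 ‹Group.IsNilpotent G›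
  -- At index `c * d + 1` the series has just reached the trivial term number `c`.
  have hbot : slowCentralSeries I Γ G d (c * d + 1) = ⊥ := by
    ext f
    rw [mem_slowCentralSeries, Nat.add_sub_cancel, Nat.mul_div_cancel _ hd, hc]
    simp [Subgroup.mem_bot, funext_iff]
  have hK := isFiltration_slowCentralSeries (I := I) (Γ := Γ) (G := G) hd
  refine hC.of_finite (isPolyFiltration_polySubgroup hK hbot) (n := c * d + 1) ?_
    (Set.finite_range _) ?_
  · rw [eq_bot_iff]
    intro f hf
    have := hK.anti (Nat.zero_le _) (IsPoly.mem hf)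
    have h := IsPoly.mem hf
    rwa [hbot] at h
  · rintro _ ⟨i, rfl⟩
    exact isPoly_slowCentralSeries (hed i) hd fun _ => he i

end Families

/-! ### Measurability on compact sets and Fubini's theorem for translates -/

section Fubini

/-- For simple `u` the map is a finite sum of restrictions of `n ↦ T n v` to measurable sets; the
general case is a pointwise limit, as each `T n` is continuous. -/
theorem aestronglyMeasurable_apply {𝕜 X H : Type*} [NontriviallyNormedField 𝕜] [MeasurableSpace X]
    {κ : Measure X} [NormedAddCommGroup H] [NormedSpace 𝕜 H] {T : X → H →L[𝕜] H}
    (hT : ∀ v, AEStronglyMeasurable (fun n => T n v) κ)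
    {u : X → H} (hu : AEStronglyMeasurable u κ) :
    AEStronglyMeasurable (fun n => T n (u n)) κ := by
  have hs : ∀ s : SimpleFunc X H, AEStronglyMeasurable (fun n => T n (s n)) κ := by
    intro s
    have e : (fun n => T n (s n)) =
        fun n => ∑ v ∈ s.range, (s ⁻¹' {v}).indicator (fun n => T n v) n := by
      funext n
      rw [Finset.sum_eq_single (s n)]
      · simp
      · intro v _ hv
        exact Set.indicator_of_notMem (fun h => hv (by simpa using h.symm)) _
      · simp
    rw [e]
    exact Finset.aestronglyMeasurable_fun_sum _
      fun v _ => (hT v).indicator (s.measurableSet_fiber v)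
  have hm := hu.stronglyMeasurable_mk
  have h1 : AEStronglyMeasurable (fun n => T n (hu.mk u n)) κ :=
    aestronglyMeasurable_of_tendsto_ae atTop (fun i => hs (hm.approx i))
      (Eventually.of_forall fun n => (T n).continuous.continuousAt.tendsto.comp
        (hm.tendsto_approx n))
  exact h1.congr (hu.ae_eq_mk.mono fun n hn => by simp only [hn])

/-- Regularity gives a compact set inside `t` and an open set around that compact set with small
measure differences; a Urysohn function between these two is the approximation. -/
theorem exists_eLpNorm_sub_indicator_le {α E : Type*} [TopologicalSpace α] [T2Space α]
    [LocallyCompactSpace α] [MeasurableSpace α] [BorelSpace α] [NormedAddCommGroup E]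
    [NormedSpace ℝ E] {κ : Measure α} [κ.Regular] (c : E) {t : Set α} (ht : MeasurableSet t)
    (htκ : κ t < ∞) {ε : ℝ≥0∞} (hε : ε ≠ 0) :
    ∃ g : α → E, eLpNorm (g - t.indicator fun _ => c) 1 κ ≤ ε ∧
      Continuous g ∧ HasCompactSupport g := by
  obtain ⟨δ, δpos, hδ⟩ := exists_Lp_half E κ 1 hε
  obtain ⟨η, ηpos, hη⟩ := exists_eLpNorm_indicator_le (μ := κ) ENNReal.one_ne_top c δpos.ne'
  have hη' : (η : ℝ≥0∞) ≠ 0 := (ENNReal.coe_pos.2 ηpos).ne'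
  obtain ⟨s, st, hs, κs⟩ := ht.exists_isCompact_sdiff_lt htκ.ne hη'
  obtain ⟨U, sU, hU, -, κU⟩ := hs.measurableSet.exists_isOpen_sdiff_lt (hs.measure_lt_top (μ := κ)).ne hη'
  obtain ⟨χ, hχ1, hχ0, hχc, hχ⟩ := exists_continuous_one_zero_of_isCompact hs hU.isClosed_compl
    (Set.disjoint_compl_right_iff_subset.2 sU)
  have hc : Continuous fun x => χ x • c := by fun_prop
  have hsupp : HasCompactSupport fun x => χ x • c := hχc.smul_right
  refine ⟨fun x => χ x • c, ?_, hc, hsupp⟩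
  have I1 : eLpNorm ((s.indicator fun _ => c) - t.indicator fun _ => c) 1 κ ≤ δ := by
    rw [← eLpNorm_neg, neg_sub, ← Set.indicator_sdiff st]
    exact hη _ κs.le
  have I2 : eLpNorm ((fun x => χ x • c) - s.indicator fun _ => c) 1 κ ≤ δ := by
    refine (eLpNorm_mono fun x => ?_).trans (hη _ κU.le)
    by_cases hxs : x ∈ s
    · simp [hxs, hχ1 hxs]
    by_cases hxU : x ∈ U
    · have h := hχ x
      simp only [Pi.sub_apply, hxs, not_false_eq_true, Set.indicator_of_notMem, sub_zero, hxU,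
        Set.indicator_of_mem, Set.mem_sdiff, and_self, norm_smul, Real.norm_eq_abs,
        abs_of_nonneg h.1]
      exact mul_le_of_le_one_left (norm_nonneg _) h.2
    · simp [hxs, hχ0 hxU]
  convert! (hδ _ _
    ((hc.integrable_of_hasCompactSupport hsupp (μ := κ)).aestronglyMeasurable.sub
      (aestronglyMeasurable_const.indicator hs.measurableSet))
    ((aestronglyMeasurable_const.indicator hs.measurableSet).sub
      (aestronglyMeasurable_const.indicator ht)) I2 I1).le using 2
  simp only [sub_add_sub_cancel]

theorem exists_hasCompactSupport_integral_sub_le {α E : Type*} [TopologicalSpace α] [T2Space α]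
    [LocallyCompactSpace α] [MeasurableSpace α] [BorelSpace α] [NormedAddCommGroup E]
    [NormedSpace ℝ E] {κ : Measure α} [κ.Regular] {f : α → E} (hf : Integrable f κ) {ε : ℝ}
    (hε : 0 < ε) :
    ∃ g : α → E, ∫ x, ‖f x - g x‖ ∂κ ≤ ε ∧ Continuous g ∧ Integrable g κ := by
  obtain ⟨g, hg, hgc, hgs⟩ : ∃ g : α → E, eLpNorm (f - g) 1 κ ≤ ENNReal.ofReal ε ∧
      (Continuous g ∧ HasCompactSupport g) := by
    refine MemLp.induction_dense ENNReal.one_ne_top _ ?_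
      (fun _ _ h₁ h₂ => ⟨h₁.1.add h₂.1, h₁.2.add h₂.2⟩)
      (fun g h => (h.1.integrable_of_hasCompactSupport h.2).aestronglyMeasurable)
      (memLp_one_iff_integrable.2 hf) (ENNReal.ofReal_pos.2 hε).ne'
    exact fun c t ht htκ ε hε => exists_eLpNorm_sub_indicator_le c ht htκ hε
  have hgi := hgc.integrable_of_hasCompactSupport hgs (μ := κ)
  refine ⟨g, ?_, hgc, hgi⟩
  rw [integral_norm_eq_lintegral_enorm (f := fun x => f x - g x) (hf.sub hgi).aestronglyMeasurable]
  rw [eLpNorm_one_eq_lintegral_enorm] at hg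
  exact ENNReal.toReal_le_of_le_ofReal hε.le hg

variable {Γ : Type*} [Group Γ] [TopologicalSpace Γ] [IsTopologicalGroup Γ] [MeasurableSpace Γ]

/-- Strong measurability with respect to `ν` on every compact set. -/
def CompactlyAEMeasurable {H : Type*} [TopologicalSpace H] (ν : Measure Γ) (u : Γ → H) : Prop :=
  ∀ K : Set Γ, IsCompact K → AEStronglyMeasurable u (ν.restrict K)

omit [Group Γ] [IsTopologicalGroup Γ] in
theorem CompactlyAEMeasurable.apply {𝕜 H : Type*} [NontriviallyNormedField 𝕜]
    [NormedAddCommGroup H] [NormedSpace 𝕜 H] {ν : Measure Γ} {T : Γ → H →L[𝕜] H}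
    (hT : ∀ v, CompactlyAEMeasurable ν fun n => T n v) {u : Γ → H}
    (hu : CompactlyAEMeasurable ν u) : CompactlyAEMeasurable ν fun n => T n (u n) :=
  fun K hK => aestronglyMeasurable_apply (fun v => hT v K hK) (hu K hK)

variable [T2Space Γ] [LocallyCompactSpace Γ] [BorelSpace Γ]
  (ν : Measure Γ) [ν.IsHaarMeasure] [ν.Regular]

omit [T2Space Γ] in
theorem exists_map_mul_right_eq (b : Γ) : ∃ c : NNReal, ν.map (· * b) = c • ν := by
  have h1 : (ν.map (· * b)).Regular :=
    Measure.Regular.map (Homeomorph.mulRight b)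
  have h2 : (ν.map (· * b)).IsMulLeftInvariant := by infer_instance
  exact ⟨_, Measure.isMulLeftInvariant_eq_smul_of_regular _ ν⟩

/-- The factor by which right translation scales Haar measure is bounded on compact sets: for a
compact neighbourhood `A` of 1, all translates `A b⁻¹` with `b ∈ F` lie in the compact set `A F⁻¹`.
-/
theorem exists_map_mul_right_le {F : Set Γ} (hF : IsCompact F) : ∃ C : ℝ, ∀ b ∈ F,
    ∃ c : NNReal, (c : ℝ) ≤ C ∧ ν.map (· * b) = c • ν := by
  obtain ⟨A, hA, hA1⟩ := exists_compact_mem_nhds (1 : Γ)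
  have hpos : 0 < ν A := Measure.measure_pos_of_mem_nhds ν hA1
  have hfin : ν (A * F⁻¹) < ∞ := (hA.mul hF.inv).measure_lt_top
  refine ⟨(ν (A * F⁻¹) / ν A).toReal, fun b hb => ?_⟩
  obtain ⟨c, hc⟩ := exists_map_mul_right_eq ν b
  refine ⟨c, ?_, hc⟩
  have h1 : (c : ℝ≥0∞) * ν A ≤ ν (A * F⁻¹) := by
    have : ν.map (· * b) A = c * ν A := by rw [hc]; rfl
    rw [← this, Measure.map_apply (measurable_mul_const b) hA.measurableSet]
    refine measure_mono fun x hx => ?_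
    exact ⟨x * b, hx, b⁻¹, Set.inv_mem_inv.2 hb, by simp⟩
  have h2 : (c : ℝ≥0∞) ≤ ν (A * F⁻¹) / ν A :=
    (ENNReal.le_div_iff_mul_le (Or.inl hpos.ne') (Or.inl hA.measure_lt_top.ne)).2 h1
  have := ENNReal.toReal_mono (ENNReal.div_lt_top hfin.ne hpos.ne').ne h2
  simpa using this

omit [T2Space Γ] in
theorem quasiMeasurePreserving_mul_mul (a b : Γ) (K : Set Γ) :
    Measure.QuasiMeasurePreserving (fun n => a * n * b) (ν.restrict K)
      (ν.restrict ((fun n => a * n * b) '' K)) := by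
  have hm : Measurable fun n : Γ => a * n * b := by fun_prop
  obtain ⟨c, hc⟩ := exists_map_mul_right_eq ν b
  have hq : Measure.QuasiMeasurePreserving (fun n => a * n * b) ν ν := by
    refine ⟨hm, ?_⟩
    have : ν.map (fun n => a * n * b) = c • ν := by
      rw [← hc]
      have : (fun n : Γ => a * n * b) = (· * b) ∘ (a * ·) := rfl
      rw [this, ← Measure.map_map (by fun_prop) (by fun_prop), map_mul_left_eq_self]
    rw [this]
    exact Measure.smul_absolutelyContinuous
  exact hq.restrict (Set.mapsTo_image _ _)

omit [T2Space Γ] in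
variable {ν} in
theorem CompactlyAEMeasurable.translate {H : Type*} [TopologicalSpace H] {u : Γ → H}
    (hu : CompactlyAEMeasurable ν u) (a b : Γ) :
    CompactlyAEMeasurable ν fun n => u (a * n * b) := fun K hK =>
  (hu _ (hK.image (by fun_prop))).comp_quasiMeasurePreserving
    (quasiMeasurePreserving_mul_mul ν a b K)

variable {𝕜 H : Type*} [RCLike 𝕜] [NormedAddCommGroup H] [InnerProductSpace 𝕜 H]

local notation "⟪" x ", " y "⟫" => inner 𝕜 x y

omit [ν.Regular] in
-- Multiplying by a cutoff that is 1 on `E ∪ F` makes `(n, m) ↦ θ (n m)` continuous with compact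
-- support. Such a function is strongly measurable for the product σ-algebra even when `Γ` is not
-- second countable, so Fubini applies.
theorem integral_swap_continuous {E F : Set Γ} (hE : IsCompact E) (hF : IsCompact F)
    {ψ θ : Γ → H} (hψ : AEStronglyMeasurable ψ (ν.restrict E)) {M : ℝ} (hM : ∀ n, ‖ψ n‖ ≤ M)
    (hθ : Continuous θ) :
    AEStronglyMeasurable (fun n => ∫ m in F, ⟪ψ n, θ (n * m)⟫ ∂ν) (ν.restrict E) ∧
    AEStronglyMeasurable (fun m => ∫ n in E, ⟪ψ n, θ (n * m)⟫ ∂ν) (ν.restrict F) ∧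
    ∫ n in E, ∫ m in F, ⟪ψ n, θ (n * m)⟫ ∂ν ∂ν = ∫ m in F, ∫ n in E, ⟪ψ n, θ (n * m)⟫ ∂ν ∂ν := by
  have : IsFiniteMeasure (ν.restrict E) := ⟨by simpa using hE.measure_lt_top⟩
  have : IsFiniteMeasure (ν.restrict F) := ⟨by simpa using hF.measure_lt_top⟩
  obtain ⟨χ, hχ1, -, hχc, -⟩ := exists_continuous_one_zero_of_isCompact (hE.union hF)
    (isClosed_empty (X := Γ)) (Set.disjoint_empty _)
  let f : Γ × Γ → H := fun p => ((χ p.1 * χ p.2 : ℝ) : 𝕜) • θ (p.1 * p.2)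
  have hfc : Continuous f := by
    have := RCLike.continuous_ofReal (K := 𝕜)
    fun_prop
  have hfs : HasCompactSupport f := by
    refine HasCompactSupport.intro (hχc.prod hχc) fun p hp => ?_
    have : p.1 ∉ tsupport χ ∨ p.2 ∉ tsupport χ := by
      by_contra! h
      exact hp ⟨h.1, h.2⟩
    rcases this with h | h <;> simp [f, image_eq_zero_of_notMem_tsupport h]
  have hf : ∀ n ∈ E, ∀ m ∈ F, f (n, m) = θ (n * m) := fun n hn m hm => by
    have h1 : χ n = 1 := hχ1 (Or.inl hn)
    have h2 : χ m = 1 := hχ1 (Or.inr hm)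
    simp [f, h1, h2]
  obtain ⟨C, hC⟩ := hfc.bounded_above_of_compact_support hfs
  have hint : Integrable (fun p : Γ × Γ => ⟪ψ p.1, f p⟫)
      ((ν.restrict E).prod (ν.restrict F)) := by
    refine Integrable.of_bound (C := M * C)
      (hψ.comp_fst.inner (hfs.stronglyMeasurable_of_prod hfc).aestronglyMeasurable)
      (Eventually.of_forall fun p => ?_)
    exact (norm_inner_le_norm _ _).trans (mul_le_mul (hM _) (hC _) (norm_nonneg _)
      ((norm_nonneg _).trans (hM p.1)))
  have e1 : ∀ n ∈ E, ∫ m in F, ⟪ψ n, f (n, m)⟫ ∂ν = ∫ m in F, ⟪ψ n, θ (n * m)⟫ ∂ν :=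
    fun n hn => setIntegral_congr_fun hF.measurableSet fun m hm => by simp only [hf n hn m hm]
  have e2 : ∀ m ∈ F, ∫ n in E, ⟪ψ n, f (n, m)⟫ ∂ν = ∫ n in E, ⟪ψ n, θ (n * m)⟫ ∂ν :=
    fun m hm => setIntegral_congr_fun hE.measurableSet fun n hn => by simp only [hf n hn m hm]
  refine ⟨?_, ?_, ?_⟩
  · refine hint.aestronglyMeasurable.integral_prod_right'.congr ?_
    filter_upwards [ae_restrict_mem hE.measurableSet] with n hn using e1 n hn
  · refine hint.aestronglyMeasurable.prod_swap.integral_prod_right'.congr ?_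
    filter_upwards [ae_restrict_mem hF.measurableSet] with m hm using e2 m hm
  · have h := integral_integral_swap (μ := ν.restrict E) (ν := ν.restrict F)
      (f := fun n m => ⟪ψ n, f (n, m)⟫) hint
    rwa [setIntegral_congr_fun hE.measurableSet e1, setIntegral_congr_fun hF.measurableSet e2] at h

/-- For merely measurable `φ` joint measurability of `φ (n m)` is not available. Instead, `φ` cut
off to `E F` is approximated in `L¹` by continuous functions, and both iterated integrals converge
by domination. Left translates keep the `L¹` norm; right translates by elements of `F` change it by
at most the factor `C`. -/
theorem integral_swap_translate {E F : Set Γ} (hE : IsCompact E) (hF : IsCompact F)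
    {ψ φ : Γ → H} (hψ : AEStronglyMeasurable ψ (ν.restrict E)) {M : ℝ} (hM : ∀ n, ‖ψ n‖ ≤ M)
    (hφ : CompactlyAEMeasurable ν φ) {M' : ℝ} (hM' : ∀ n, ‖φ n‖ ≤ M') :
    AEStronglyMeasurable (fun n => ∫ m in F, ⟪ψ n, φ (n * m)⟫ ∂ν) (ν.restrict E) ∧
    AEStronglyMeasurable (fun m => ∫ n in E, ⟪ψ n, φ (n * m)⟫ ∂ν) (ν.restrict F) ∧
    ∫ n in E, ∫ m in F, ⟪ψ n, φ (n * m)⟫ ∂ν ∂ν = ∫ m in F, ∫ n in E, ⟪ψ n, φ (n * m)⟫ ∂ν ∂ν := by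
  have : IsFiniteMeasure (ν.restrict E) := ⟨by simpa using hE.measure_lt_top⟩
  have : IsFiniteMeasure (ν.restrict F) := ⟨by simpa using hF.measure_lt_top⟩
  have hM0 : 0 ≤ M := (norm_nonneg _).trans (hM 1)
  have hEF := hE.mul hF
  set φ' := (E * F).indicator φ with hφ'
  have hφ'e : ∀ n ∈ E, ∀ m ∈ F, φ (n * m) = φ' (n * m) := fun n hn m hm =>
    (Set.indicator_of_mem (Set.mul_mem_mul hn hm) _).symm
  have hφ'i : Integrable φ' ν := by
    rw [hφ', integrable_indicator_iff hEF.measurableSet]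
    have : IsFiniteMeasure (ν.restrict (E * F)) := ⟨by simpa using hEF.measure_lt_top⟩
    exact Integrable.of_bound (hφ _ hEF) M' (Eventually.of_forall hM')
  have e1 : ∀ n ∈ E, ∫ m in F, ⟪ψ n, φ (n * m)⟫ ∂ν = ∫ m in F, ⟪ψ n, φ' (n * m)⟫ ∂ν :=
    fun n hn => setIntegral_congr_fun hF.measurableSet fun m hm => by simp only [hφ'e n hn m hm]
  have e2 : ∀ m ∈ F, ∫ n in E, ⟪ψ n, φ (n * m)⟫ ∂ν = ∫ n in E, ⟪ψ n, φ' (n * m)⟫ ∂ν :=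
    fun m hm => setIntegral_congr_fun hE.measurableSet fun n hn => by simp only [hφ'e n hn m hm]
  have hae : (fun m => ∫ n in E, ⟪ψ n, φ' (n * m)⟫ ∂ν) =ᵐ[ν.restrict F]
      fun m => ∫ n in E, ⟪ψ n, φ (n * m)⟫ ∂ν := by
    filter_upwards [ae_restrict_mem hF.measurableSet] with m hm using (e2 m hm).symm
  rw [setIntegral_congr_fun hE.measurableSet e1, setIntegral_congr_fun hF.measurableSet e2]
  have hNS : NormedSpace ℝ H := NormedSpace.restrictScalars ℝ 𝕜 H
  choose θ hθ hθcont hθi using fun i : ℕ => exists_hasCompactSupport_integral_sub_le hφ'i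
    (Nat.one_div_pos_of_nat (α := ℝ) (n := i))
  have sw := fun i => integral_swap_continuous (𝕜 := 𝕜) ν hE hF hψ hM (hθcont i)
  obtain ⟨C, hC⟩ := exists_map_mul_right_le ν hF
  have hleft : ∀ (f : Γ → H) n, Integrable f ν → Integrable (fun m => f (n * m)) ν :=
    fun f n hf => hf.comp_mul_left n
  have hright : ∀ (f : Γ → H), Integrable f ν → ∀ m ∈ F, Integrable (fun n => f (n * m)) ν ∧
      ∫ n, ‖f (n * m)‖ ∂ν ≤ C * ∫ n, ‖f n‖ ∂ν := by
    intro f hf m hm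
    obtain ⟨c, hcC, hc⟩ := hC m hm
    constructor
    · have h : Integrable f (ν.map (MeasurableEquiv.mulRight m)) := by
        change Integrable f (ν.map (· * m))
        rw [hc]
        exact hf.smul_measure_nnreal
      exact (integrable_map_equiv (MeasurableEquiv.mulRight m) f).1 h
    · have h := integral_map_equiv (μ := ν) (MeasurableEquiv.mulRight m) fun x => ‖f x‖
      change ∫ y, ‖f y‖ ∂(ν.map (· * m)) = ∫ x, ‖f (x * m)‖ ∂ν at h
      rw [← h, hc, integral_smul_nnreal_measure]
      exact mul_le_mul_of_nonneg_right hcC (integral_nonneg fun _ => norm_nonneg _)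
  have bnd : ∀ (f : Γ → H) (S : Set Γ) (ψ' : Γ → H), (∀ n, ‖ψ' n‖ ≤ M) → Integrable f ν →
      ‖∫ n in S, ⟪ψ' n, f n⟫ ∂ν‖ ≤ M * ∫ n, ‖f n‖ ∂ν := by
    intro f S ψ' hψ' hf
    calc ‖∫ n in S, ⟪ψ' n, f n⟫ ∂ν‖ ≤ ∫ n in S, M * ‖f n‖ ∂ν := by
          refine norm_integral_le_of_norm_le (hf.norm.const_mul M).restrict
            (Eventually.of_forall fun n => ?_)
          exact (norm_inner_le_norm _ _).trans
            (mul_le_mul_of_nonneg_right (hψ' n) (norm_nonneg _))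
      _ ≤ ∫ n, M * ‖f n‖ ∂ν := setIntegral_le_integral (hf.norm.const_mul M)
          (Eventually.of_forall fun n => mul_nonneg hM0 (norm_nonneg _))
      _ = M * ∫ n, ‖f n‖ ∂ν := integral_const_mul _ _
  have iint : ∀ (f : Γ → H) (S : Set Γ) (ψ' : Γ → H), (∀ n, ‖ψ' n‖ ≤ M) →
      AEStronglyMeasurable ψ' (ν.restrict S) → Integrable f ν →
      Integrable (fun n => ⟪ψ' n, f n⟫) (ν.restrict S) := by
    intro f S ψ' hψ' hψm hf
    refine (hf.norm.const_mul M).restrict.mono' (hψm.inner hf.aestronglyMeasurable.restrict)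
      (Eventually.of_forall fun n => ?_)
    exact (norm_inner_le_norm _ _).trans (mul_le_mul_of_nonneg_right (hψ' n) (norm_nonneg _))
  have hlim : Tendsto (fun i : ℕ => 1 / ((i : ℝ) + 1)) atTop (𝓝 0) :=
    tendsto_one_div_add_atTop_nhds_zero_nat
  have hnorm : ∀ i, ∫ x, ‖θ i x‖ ∂ν ≤ ∫ x, ‖φ' x‖ ∂ν + 1 := by
    intro i
    have h1 : ∫ x, ‖θ i x‖ ∂ν ≤ ∫ x, (‖φ' x‖ + ‖φ' x - θ i x‖) ∂ν := by
      refine integral_mono (hθi i).norm (hφ'i.norm.add (hφ'i.sub (hθi i)).norm) fun x => ?_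
      simpa using norm_sub_le (φ' x) (φ' x - θ i x)
    rw [integral_add (g := fun x => ‖φ' x - θ i x‖) hφ'i.norm (hφ'i.sub (hθi i)).norm] at h1
    have h2 : 1 / ((i : ℝ) + 1) ≤ 1 := by
      rw [div_le_one (by positivity)]; linarith [(Nat.cast_nonneg i : (0 : ℝ) ≤ i)]
    linarith [hθ i]
  have P1 : ∀ n, Tendsto (fun i => ∫ m in F, ⟪ψ n, θ i (n * m)⟫ ∂ν) atTop
      (𝓝 (∫ m in F, ⟪ψ n, φ' (n * m)⟫ ∂ν)) := by
    intro n
    rw [tendsto_iff_norm_sub_tendsto_zero]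
    refine squeeze_zero (fun _ => norm_nonneg _) (fun i => ?_)
      (by simpa only [mul_zero] using hlim.const_mul M)
    rw [norm_sub_rev, ← integral_sub
      (iint _ F _ (fun _ => hM n) aestronglyMeasurable_const (hleft _ n hφ'i))
      (iint _ F _ (fun _ => hM n) aestronglyMeasurable_const (hleft _ n (hθi i)))]
    simp only [← inner_sub_right]
    refine (bnd (fun m => φ' (n * m) - θ i (n * m)) F (fun _ => ψ n) (fun _ => hM n)
      (hleft _ n (hφ'i.sub (hθi i)))).trans ?_
    rw [integral_mul_left_eq_self fun x => ‖φ' x - θ i x‖]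
    exact mul_le_mul_of_nonneg_left (hθ i) hM0
  have L1 : Tendsto (fun i => ∫ n in E, ∫ m in F, ⟪ψ n, θ i (n * m)⟫ ∂ν ∂ν) atTop
      (𝓝 (∫ n in E, ∫ m in F, ⟪ψ n, φ' (n * m)⟫ ∂ν ∂ν)) := by
    refine tendsto_integral_of_dominated_convergence
      (fun _ => M * (∫ x, ‖φ' x‖ ∂ν + 1)) (fun i => (sw i).1) (integrable_const _)
      (fun i => Eventually.of_forall fun n => ?_) (Eventually.of_forall P1)
    refine (bnd _ F (fun _ => ψ n) (fun _ => hM n) (hleft _ n (hθi i))).trans ?_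
    rw [integral_mul_left_eq_self fun x => ‖θ i x‖]
    exact mul_le_mul_of_nonneg_left (hnorm i) hM0
  have hC0 : ∀ m ∈ F, 0 ≤ C := fun m hm => by
    obtain ⟨c, hcC, -⟩ := hC m hm
    exact c.coe_nonneg.trans hcC
  have P2 : ∀ m ∈ F, Tendsto (fun i => ∫ n in E, ⟪ψ n, θ i (n * m)⟫ ∂ν) atTop
      (𝓝 (∫ n in E, ⟪ψ n, φ' (n * m)⟫ ∂ν)) := by
    intro m hm
    rw [tendsto_iff_norm_sub_tendsto_zero]
    refine squeeze_zero (fun _ => norm_nonneg _) (fun i => ?_)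
      (by simpa only [mul_zero] using hlim.const_mul (M * C))
    rw [norm_sub_rev, ← integral_sub (iint _ E _ hM hψ (hright _ hφ'i m hm).1)
      (iint _ E _ hM hψ (hright _ (hθi i) m hm).1)]
    simp only [← inner_sub_right]
    obtain ⟨h1, h2⟩ := hright _ (hφ'i.sub (hθi i)) m hm
    refine (bnd (fun n => φ' (n * m) - θ i (n * m)) E ψ hM h1).trans ?_
    rw [mul_assoc]
    exact mul_le_mul_of_nonneg_left
      (h2.trans (mul_le_mul_of_nonneg_left (hθ i) (hC0 m hm))) hM0
  have hae2 : ∀ᵐ m ∂(ν.restrict F), Tendsto (fun i => ∫ n in E, ⟪ψ n, θ i (n * m)⟫ ∂ν) atTop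
      (𝓝 (∫ n in E, ⟪ψ n, φ' (n * m)⟫ ∂ν)) := by
    filter_upwards [ae_restrict_mem hF.measurableSet] with m hm using P2 m hm
  have L2 : Tendsto (fun i => ∫ m in F, ∫ n in E, ⟪ψ n, θ i (n * m)⟫ ∂ν ∂ν) atTop
      (𝓝 (∫ m in F, ∫ n in E, ⟪ψ n, φ' (n * m)⟫ ∂ν ∂ν)) := by
    refine tendsto_integral_of_dominated_convergence
      (fun _ => M * (C * (∫ x, ‖φ' x‖ ∂ν + 1))) (fun i => (sw i).2.1) (integrable_const _)
      (fun i => ?_) hae2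
    filter_upwards [ae_restrict_mem hF.measurableSet] with m hm
    obtain ⟨h1, h2⟩ := hright _ (hθi i) m hm
    exact (bnd _ E ψ hM h1).trans (mul_le_mul_of_nonneg_left
      (h2.trans (mul_le_mul_of_nonneg_left (hnorm i) (hC0 m hm))) hM0)
  have hae' : (fun n => ∫ m in F, ⟪ψ n, φ' (n * m)⟫ ∂ν) =ᵐ[ν.restrict E]
      fun n => ∫ m in F, ⟪ψ n, φ (n * m)⟫ ∂ν := by
    filter_upwards [ae_restrict_mem hE.measurableSet] with n hn using (e1 n hn).symm
  refine ⟨(aestronglyMeasurable_of_tendsto_ae atTop (fun i => (sw i).1)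
    (Eventually.of_forall P1)).congr hae',
    (aestronglyMeasurable_of_tendsto_ae atTop (fun i => (sw i).2.1) hae2).congr hae,
    tendsto_nhds_unique L1 (L2.congr fun i => (sw i).2.2.symm)⟩

end Fubini

/-! ### Limits along an ultrafilter on the natural numbers -/

section Ultra

/-- A fixed nonprincipal ultrafilter on `ℕ`. -/
noncomputable abbrev natUltra : Ultrafilter ℕ := Filter.hyperfilter ℕ

/-- Overspill: `r x` is the largest `N ≤ x` with `X N x`. Nonprincipality of the ultrafilter makes
the bound `x` eventually irrelevant for each fixed `N`. -/
theorem exists_diagonal {X : ℕ → ℕ → Prop} (hX : ∀ N, ∀ᶠ x in natUltra, X N x) :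
    ∃ r : ℕ → ℕ, Tendsto r natUltra atTop ∧ ∀ᶠ x in natUltra, X (r x) x := by
  classical
  refine ⟨fun x => Nat.findGreatest (fun N => X N x) x, tendsto_atTop.2 fun N => ?_, ?_⟩
  · have h : ∀ᶠ x : ℕ in natUltra, N ≤ x :=
      Nat.hyperfilter_le_atTop (eventually_ge_atTop N)
    filter_upwards [h, hX N] with x h1 h2 using Nat.le_findGreatest h1 h2
  · filter_upwards [hX 0] with x hx
    exact Nat.findGreatest_spec (P := fun N => X N x) (Nat.zero_le x) hx

/-- A finitary form of the fact that the limsup of sets of measure at least `δ` has measure at least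
`δ`, hence is nonempty. The unions from `l` on are replaced by finite unions `D l` exhausting them
up to a summable error. -/
theorem exists_frequently_mem {Y : Type*} [Nonempty Y] [MeasurableSpace Y] (κ : ℕ → Measure Y)
    [∀ x, IsFiniteMeasure (κ x)] (hκ : ∀ x, (κ x).real Set.univ ≤ 1) (B : ℕ → ℕ → Set Y)
    (hB : ∀ i x, MeasurableSet (B i x)) {δ : ℝ} (hδ : 0 < δ)
    (hBδ : ∀ i, ∀ᶠ x in natUltra, δ ≤ (κ x).real (B i x)) :
    ∃ y : ℕ → Y, ∀ N, ∃ i ≥ N, ∀ᶠ x in natUltra, y x ∈ B i x := by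
  let C : ℕ → ℕ → ℕ → Set Y := fun l L x => ⋃ i ∈ Finset.Icc l L, B i x
  have hC : ∀ l L x, MeasurableSet (C l L x) := fun l L x =>
    Finset.measurableSet_biUnion _ fun i _ => hB i x
  have Cmono : ∀ {l l' L L'} x, l' ≤ l → L ≤ L' → C l L x ⊆ C l' L' x := by
    intro l l' L L' x h1 h2
    refine Set.biUnion_subset_biUnion_left fun i hi => ?_
    simp only [Finset.coe_Icc, Set.mem_Icc] at hi ⊢
    omega
  -- Otherwise the finite unions could be enlarged again and again, each time gaining measure `η`,
  -- and would exceed total mass 1.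
  have step : ∀ l (η : ℝ), 0 < η → ∃ M, l ≤ M ∧ ∀ L, ∀ᶠ x in natUltra,
      (κ x).real (C l L x \ C l M x) ≤ η := by
    intro l η hη
    by_contra! H
    have grow : ∀ n : ℕ, ∃ M, l ≤ M ∧ ∀ᶠ x in natUltra, n * η ≤ (κ x).real (C l M x) := by
      intro n
      induction n with
      | zero => exact ⟨l, le_rfl, Eventually.of_forall fun x => by simp⟩
      | succ n ih =>
        obtain ⟨M, hM, hx⟩ := ih
        obtain ⟨L, hL⟩ := H M hM
        refine ⟨max M L, hM.trans (le_max_left _ _), ?_⟩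
        filter_upwards [hx, hL] with x h1 h2
        have h3 : (κ x).real (C l M x ∪ (C l L x \ C l M x)) ≤ (κ x).real (C l (max M L) x) :=
          measureReal_mono (Set.union_subset (Cmono x le_rfl (le_max_left _ _))
            (Set.sdiff_subset.trans (Cmono x le_rfl (le_max_right _ _)))) (measure_ne_top _ _)
        rw [measureReal_union Set.disjoint_sdiff_right ((hC _ _ _).diff (hC _ _ _))
            (measure_ne_top _ _) (measure_ne_top _ _)] at h3
        push_cast
        linarith
    obtain ⟨n, hn⟩ := exists_nat_gt (1 / η)
    obtain ⟨M, -, hM⟩ := grow n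
    obtain ⟨x, hx⟩ := hM.exists
    have h1 : (κ x).real (C l M x) ≤ 1 := (measureReal_mono (Set.subset_univ _)).trans (hκ x)
    rw [div_lt_iff₀ hη] at hn
    linarith
  choose M hM hMη using fun l => step l (δ / 4 * (1 / 2) ^ l) (by positivity)
  let D : ℕ → ℕ → Set Y := fun l x => C l (M l) x
  -- `B r x` lies in every `C l (M r) x` with `l ≤ r`. The errors sum to at most `δ / 2`, less than
  -- the measure of `B r x`, so some point of it survives in all `D l x`.
  have inter : ∀ r, ∀ᶠ x in natUltra, ∃ y, ∀ l ≤ r, y ∈ D l x := by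
    intro r
    have h1 : ∀ᶠ x in natUltra, ∀ l ∈ Finset.range (r + 1),
        (κ x).real (C l (M r) x \ D l x) ≤ δ / 4 * (1 / 2) ^ l :=
      (Filter.eventually_all_finset _).2 fun l _ => hMη l (M r)
    filter_upwards [h1, hBδ r] with x h1 h2
    by_contra! H
    have hsub : B r x ⊆ ⋃ l ∈ Finset.range (r + 1), (C l (M r) x \ D l x) := by
      intro y hy
      obtain ⟨l, hl, hyl⟩ := H y
      simp only [Set.mem_iUnion, Finset.mem_range]
      refine ⟨l, by omega, ?_, hyl⟩
      simp only [C, Set.mem_iUnion, Finset.mem_Icc]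
      exact ⟨r, ⟨hl, hM r⟩, hy⟩
    have h3 := (measureReal_mono (μ := κ x) hsub (measure_ne_top _ _)).trans (measureReal_biUnion_finset_le _ _)
    have h4 := h3.trans (Finset.sum_le_sum h1)
    rw [← Finset.mul_sum] at h4
    have h5 : ∑ l ∈ Finset.range (r + 1), ((1 : ℝ) / 2) ^ l ≤ 2 := sum_geometric_two_le _
    nlinarith
  obtain ⟨r, hr, hrx⟩ := exists_diagonal inter
  have : ∃ y : ℕ → Y, ∀ᶠ x in natUltra, ∀ l ≤ r x, y x ∈ D l x := by
    classical
    refine ⟨fun x => if h : ∃ y, ∀ l ≤ r x, y ∈ D l x then h.choose else Classical.arbitrary Y, ?_⟩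
    filter_upwards [hrx] with x hx
    rw [dif_pos hx]
    exact hx.choose_spec
  obtain ⟨y, hy⟩ := this
  refine ⟨y, fun N => ?_⟩
  have h1 : ∀ᶠ x in natUltra, y x ∈ D N x := by
    filter_upwards [hy, hr.eventually_ge_atTop N] with x h1 h2 using h1 N h2
  have h2 : (⋃ i ∈ (Finset.Icc N (M N) : Set ℕ), {x | y x ∈ B i x}) ∈ natUltra := by
    refine mem_of_superset h1 fun x hx => ?_
    simpa [D, C] using hx
  -- An ultrafilter set covered by finitely many sets picks out one of them, hence one index `i` in
  -- `[N, M N]` for almost all `x`.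
  obtain ⟨i, hi, hix⟩ := (Ultrafilter.finite_biUnion_mem_iff (Finset.finite_toSet _)).1 h2
  exact ⟨i, by simpa using (Finset.mem_Icc.1 hi).1, hix⟩

/-- Reverse Markov inequality, from `2c ≤ ∫ b ≤ c + M κ(B)`. As `b` is only almost everywhere
measurable, `B` is a measurable subset of full measure in `{c < b}`. -/
theorem exists_measurable_subset_real_ge {Y : Type*} [MeasurableSpace Y] {κ : Measure Y}
    [IsProbabilityMeasure κ] {b : Y → ℝ} (hb : AEStronglyMeasurable b κ) {M c : ℝ} (hM : 0 < M)
    (hbM : ∀ y, |b y| ≤ M) (hc : 0 ≤ c) (hint : 2 * c ≤ ∫ y, b y ∂κ) :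
    ∃ B, MeasurableSet B ∧ B ⊆ {y | c < b y} ∧ c / M ≤ κ.real B := by
  have hnull : NullMeasurableSet {y | c < b y} κ :=
    nullMeasurableSet_lt aemeasurable_const hb.aemeasurable
  obtain ⟨B, hBsub, hB, hBae⟩ := hnull.exists_measurable_subset_ae_eq
  refine ⟨B, hB, hBsub, ?_⟩
  have h1 : ∫ y, b y ∂κ ≤ ∫ y, (c + B.indicator (fun _ => M) y) ∂κ := by
    refine integral_mono_ae (Integrable.of_bound hb M (Eventually.of_forall fun y => hbM y))
      ((integrable_const c).add ((integrable_const M).indicator hB)) ?_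
    filter_upwards [hBae] with y hy
    by_cases hyB : y ∈ B
    · simp only [hyB, Set.indicator_of_mem]
      linarith [(le_abs_self _).trans (hbM y)]
    · have : ¬ c < b y := fun h => hyB (hy.mpr h)
      simp only [hyB, not_false_eq_true, Set.indicator_of_notMem]
      linarith
  rw [integral_add (integrable_const c) ((integrable_const M).indicator hB),
    integral_indicator_const _ hB] at h1
  simp only [integral_const, probReal_univ, smul_eq_mul, one_mul] at h1
  rw [div_le_iff₀ hM]
  linarith

variable {𝕜 H : Type*} [RCLike 𝕜] [NormedAddCommGroup H] [InnerProductSpace 𝕜 H]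
  [NormedSpace ℝ H]

/-- Uniform Cauchy property along the ultrafilter of the images of a family of vectors. -/
def CauchyFam (T : ℕ → ℕ → H →ₗ[ℝ] H) (u : ℕ → H) : Prop :=
  ∀ ε : ℝ, 0 < ε → ∃ N, ∀ k ≥ N, ∀ l ≥ N, ∀ᶠ x in natUltra, ‖T k x (u x) - T l x (u x)‖ ≤ ε

theorem CauchyFam.add {T : ℕ → ℕ → H →ₗ[ℝ] H} {u v : ℕ → H} (hu : CauchyFam T u)
    (hv : CauchyFam T v) : CauchyFam T (u + v) := by
  intro ε hε
  obtain ⟨N, hN⟩ := hu (ε / 2) (half_pos hε)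
  obtain ⟨N', hN'⟩ := hv (ε / 2) (half_pos hε)
  refine ⟨max N N', fun k hk l hl => ?_⟩
  filter_upwards [hN k (le_of_max_le_left hk) l (le_of_max_le_left hl),
    hN' k (le_of_max_le_right hk) l (le_of_max_le_right hl)] with x h1 h2
  simp only [Pi.add_apply, map_add]
  rw [add_sub_add_comm]
  exact (norm_add_le _ _).trans (by linarith)

theorem CauchyFam.smul {T : ℕ → ℕ → H →ₗ[ℝ] H} {u : ℕ → H} (hu : CauchyFam T u) (c : ℝ) :
    CauchyFam T (c • u) := by
  intro ε hε
  obtain ⟨N, hN⟩ := hu (ε / (|c| + 1)) (by positivity)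
  refine ⟨N, fun k hk l hl => ?_⟩
  filter_upwards [hN k hk l hl] with x h1
  simp only [Pi.smul_apply, map_smul]
  rw [← smul_sub, norm_smul, Real.norm_eq_abs]
  calc |c| * ‖T k x (u x) - T l x (u x)‖ ≤ |c| * (ε / (|c| + 1)) := by gcongr
    _ = ε * (|c| / (|c| + 1)) := by ring
    _ ≤ ε * 1 := by
      gcongr
      rw [div_le_one (by positivity)]; linarith
    _ = ε := mul_one ε

variable (𝕜) in
/-- If all families obtained from the adjoint operators at scales tending to infinity are Cauchy,
then so is every family in `D`. -/
theorem cauchyFam_of_structured [IsScalarTower ℝ 𝕜 H] {D : Set H} (hconv : Convex ℝ D)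
    (hneg : ∀ d ∈ D, -d ∈ D) (hD1 : ∀ d ∈ D, ‖d‖ ≤ 1)
    {T T' : ℕ → ℕ → H →ₗ[ℝ] H} (hT : ∀ k x u, ‖T k x u‖ ≤ ‖u‖) (hT' : ∀ k x u, ‖T' k x u‖ ≤ ‖u‖)
    (hTD : ∀ k x, ∀ d ∈ D, T k x d ∈ D) (hTD' : ∀ k x, ∀ d ∈ D, T' k x d ∈ D)
    (hadj : ∀ k x u h, inner 𝕜 u (T' k x h) = inner 𝕜 (T k x u) h)
    (structured : ∀ n : ℕ → ℕ, Tendsto n natUltra atTop → ∀ h : ℕ → H, (∀ x, h x ∈ D) →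
      CauchyFam T fun x => T' (n x) x (h x))
    (u : ℕ → H) (hu : ∀ x, u x ∈ D) : CauchyFam T u := by
  -- Squared errors achievable when approximating `u` by Cauchy families in a multiple of `D`. The
  -- multiple `R` is unrestricted but independent of `x`.
  let Ach : Set ℝ := {e | ∃ (σ : ℕ → H) (R : ℝ), 0 ≤ R ∧ CauchyFam T σ ∧ (∀ x, σ x ∈ R • D) ∧
    ∀ᶠ x in natUltra, ‖u x - σ x‖ ^ 2 ≤ e}
  have h0D : (0 : H) ∈ D := by
    have := hconv (hu 0) (hneg _ (hu 0)) (a := 1 / 2) (b := 1 / 2) (by norm_num) (by norm_num)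
      (by norm_num)
    simpa using this
  have hA1 : (1 : ℝ) ∈ Ach := by
    refine ⟨0, 0, le_rfl, fun ε hε => ⟨0, fun k _ l _ => Eventually.of_forall fun x => ?_⟩,
      fun x => ⟨0, h0D, by simp⟩, Eventually.of_forall fun x => ?_⟩
    · simpa using hε.le
    · have := hD1 _ (hu x)
      simp only [Pi.zero_apply, sub_zero]
      nlinarith [norm_nonneg (u x)]
  have hAbdd : BddBelow Ach := ⟨0, by
    rintro e ⟨σ, R, -, -, -, h⟩
    obtain ⟨x, hx⟩ := h.exists
    exact (sq_nonneg _).trans hx⟩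
  intro ε hε
  set ε' := ε / 3 with hε'
  have hε'0 : 0 < ε' := by positivity
  obtain ⟨e, ⟨σ, R, hR, hσ, hσD, he⟩, hlt⟩ := exists_lt_of_csInf_lt ⟨1, hA1⟩
    (lt_add_of_pos_right (sInf Ach) (lt_min (by positivity : 0 < ε' ^ 4 / 2) one_pos))
  have he2 : e ≤ 2 := by
    have := csInf_le hAbdd hA1
    linarith [min_le_right (ε' ^ 4 / 2) 1]
  have hwD : ∀ x, u x - σ x ∈ (1 + R) • D := by
    intro x
    rw [hconv.add_smul zero_le_one hR]
    obtain ⟨d, hd, hd'⟩ := hσD x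
    refine ⟨u x, ⟨u x, hu x, one_smul _ _⟩, R • (-d), ⟨-d, hneg d hd, rfl⟩, ?_⟩
    simp only at hd' ⊢
    rw [← hd', smul_neg, sub_eq_add_neg]
  by_cases good : ∃ N, ∀ k ≥ N, ∀ᶠ x in natUltra, ‖T k x (u x - σ x)‖ ≤ ε'
  · obtain ⟨N, hN⟩ := good
    obtain ⟨N', hN'⟩ := hσ ε' hε'0
    refine ⟨max N N', fun k hk l hl => ?_⟩
    filter_upwards [hN k (le_of_max_le_left hk), hN l (le_of_max_le_left hl),
      hN' k (le_of_max_le_right hk) l (le_of_max_le_right hl)] with x h1 h2 h3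
    have e1 : T k x (u x) - T l x (u x) =
        (T k x (u x - σ x) - T l x (u x - σ x)) + (T k x (σ x) - T l x (σ x)) := by
      simp only [map_sub]; abel
    rw [e1]
    have := norm_add_le (T k x (u x - σ x) - T l x (u x - σ x)) (T k x (σ x) - T l x (σ x))
    have := norm_sub_le (T k x (u x - σ x)) (T l x (u x - σ x))
    rw [hε'] at *
    linarith
  · exfalso
    push Not at good
    choose k hk hkx using good
    -- The bad scales are combined into one scale per `x` that tends to infinity, as `structured`
    -- requires.
    obtain ⟨r, hr, hrx⟩ := exists_diagonal (X := fun N x => ε' < ‖T (k N) x (u x - σ x)‖)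
      fun N => hkx N
    set n : ℕ → ℕ := fun x => k (r x) with hn
    have hn' : Tendsto n natUltra atTop := tendsto_atTop_mono (fun x => hk (r x)) hr
    have hR1 : 0 < 1 + R := by linarith
    have hDh : ∀ x, ∃ d ∈ D, (1 + R) • d = T (n x) x (u x - σ x) := by
      intro x
      obtain ⟨d, hd, hd'⟩ := hwD x
      exact ⟨T (n x) x d, hTD _ _ d hd, by rw [← map_smul]; exact congrArg _ hd'⟩
    choose d hd hdh using hDh
    set σ' : ℕ → H := (1 + R) • fun x => T' (n x) x (d x) with hσ'
    have hσ'C : CauchyFam T σ' := (structured n hn' d hd).smul _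
    have hσ'x : ∀ x, σ' x = T' (n x) x (T (n x) x (u x - σ x)) := by
      intro x
      rw [← hdh x, map_smul]; rfl
    -- This minimises `-2 c ε'² + 2 c²`, the bound for the change in squared error when `c • σ'` is
    -- subtracted (using `‖w‖² ≤ 2`). The gain is `ε' ^ 4 / 2`, exceeding the distance of `e` from
    -- the infimum.
    set c := ε' ^ 2 / 2 with hc
    have hc0 : 0 < c := by positivity
    have hmem : e - ε' ^ 4 / 2 ∈ Ach := by
      refine ⟨σ + c • σ', R + c * (1 + R), by positivity, hσ.add (hσ'C.smul c), fun x => ?_, ?_⟩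
      · rw [hconv.add_smul hR (by positivity)]
        refine ⟨σ x, hσD x, c • σ' x, ⟨T' (n x) x (d x), hTD' _ _ _ (hd x), ?_⟩, rfl⟩
        simp [hσ', mul_smul]
      · filter_upwards [he, hrx] with x h1 h2
        have h3 : ε' < ‖T (n x) x (u x - σ x)‖ := h2
        set w := u x - σ x with hw
        have e1 : u x - (σ + c • σ') x = w - (c : 𝕜) • σ' x := by
          simp only [Pi.add_apply, Pi.smul_apply, hw, RCLike.real_smul_eq_coe_smul (K := 𝕜)]
          abel
        have e2 : inner 𝕜 w (σ' x) = ((‖T (n x) x w‖ ^ 2 : ℝ) : 𝕜) := by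
          rw [hσ'x, hadj, inner_self_eq_norm_sq_to_K]; norm_cast
        have h4 : ‖σ' x‖ ≤ ‖w‖ := by
          rw [hσ'x]; exact (hT' _ _ _).trans (hT _ _ _)
        rw [e1, @norm_sub_sq 𝕜, inner_smul_right, e2, norm_smul]
        rw [← RCLike.ofReal_mul, RCLike.ofReal_re, RCLike.norm_ofReal, abs_of_pos hc0]
        have h5 : ε' ^ 2 ≤ ‖T (n x) x w‖ ^ 2 := by gcongr
        have h6 : ‖σ' x‖ ^ 2 ≤ 2 := by
          calc ‖σ' x‖ ^ 2 ≤ ‖w‖ ^ 2 := by gcongr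
            _ ≤ 2 := h1.trans he2
        have h7 : c * ε' ^ 2 ≤ c * ‖T (n x) x w‖ ^ 2 := by gcongr
        have h8 : (c * ‖σ' x‖) ^ 2 ≤ c ^ 2 * 2 := by rw [mul_pow]; gcongr
        have h9 : c ^ 2 * 2 = ε' ^ 4 / 2 := by rw [hc]; ring
        have h10 : c * ε' ^ 2 = ε' ^ 4 / 2 := by rw [hc]; ring
        linarith
    have := csInf_le hAbdd hmem
    linarith [min_le_left (ε' ^ 4 / 2) 1]

end Ultra

/-! ### Averages over compact sets -/

section Averages

open ProbabilityTheory

variable {Γ : Type*} [Group Γ] [TopologicalSpace Γ] [IsTopologicalGroup Γ] [MeasurableSpace Γ]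

/-- A compact set of positive measure. -/
structure IsAvgSet (ν : Measure Γ) (F : Set Γ) : Prop where
  isCompact : IsCompact F
  pos : 0 < ν F

/-- A bounded function that is strongly measurable on compact sets. -/
structure BddMeas {H : Type*} [NormedAddCommGroup H] (ν : Measure Γ) (Φ : Γ → H) (M : ℝ) :
    Prop where
  meas : CompactlyAEMeasurable ν Φ
  bdd : ∀ n, ‖Φ n‖ ≤ M

variable {𝕜 H : Type*} [RCLike 𝕜] [NormedAddCommGroup H] [InnerProductSpace 𝕜 H]

/-- A strongly measurable field of contractions. -/
structure IsContractionField (ν : Measure Γ) (W : Γ → H →L[𝕜] H) : Prop where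
  meas : ∀ v, CompactlyAEMeasurable ν fun n => W n v
  norm_le : ∀ n, ‖W n‖ ≤ 1

omit [Group Γ] [IsTopologicalGroup Γ] in
theorem IsContractionField.norm_apply_le {ν : Measure Γ} {W : Γ → H →L[𝕜] H}
    (hW : IsContractionField ν W) (n : Γ) (v : H) : ‖W n v‖ ≤ ‖v‖ := by
  simpa using (W n).le_of_opNorm_le (hW.norm_le n) v

omit [Group Γ] [IsTopologicalGroup Γ] in
theorem IsContractionField.bddMeas {ν : Measure Γ} {W : Γ → H →L[𝕜] H}
    (hW : IsContractionField ν W) (v : H) : BddMeas ν (fun n => W n v) ‖v‖ :=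
  ⟨hW.meas v, fun n => hW.norm_apply_le n v⟩

omit [Group Γ] [IsTopologicalGroup Γ] in
theorem IsContractionField.mul {ν : Measure Γ} {W V : Γ → H →L[𝕜] H}
    (hW : IsContractionField ν W) (hV : IsContractionField ν V) :
    IsContractionField ν fun n => W n * V n where
  meas v := CompactlyAEMeasurable.apply hW.meas (hV.meas v)
  norm_le n := (norm_mul_le _ _).trans (mul_le_one₀ (hW.norm_le n) (norm_nonneg _) (hV.norm_le n))

omit [Group Γ] [IsTopologicalGroup Γ] in
theorem isContractionField_const (ν : Measure Γ) {T : H →L[𝕜] H} (hT : ‖T‖ ≤ 1) :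
    IsContractionField ν fun _ => T :=
  ⟨fun _ _ _ => aestronglyMeasurable_const, fun _ => hT⟩

variable [T2Space Γ] [LocallyCompactSpace Γ] [BorelSpace Γ]
  {ν : Measure Γ} [ν.IsHaarMeasure] [ν.Regular] {F E : Set Γ}

omit [IsTopologicalGroup Γ] [T2Space Γ] [LocallyCompactSpace Γ] [BorelSpace Γ] [ν.Regular] in
theorem IsAvgSet.isProbabilityMeasure (hF : IsAvgSet ν F) : IsProbabilityMeasure (cond ν F) :=
  cond_isProbabilityMeasure_of_finite hF.pos.ne' hF.isCompact.measure_lt_top.ne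

omit [IsTopologicalGroup Γ] [T2Space Γ] [LocallyCompactSpace Γ] [BorelSpace Γ] [ν.Regular] in
theorem IsAvgSet.real_pos (hF : IsAvgSet ν F) : 0 < ν.real F :=
  ENNReal.toReal_pos hF.pos.ne' hF.isCompact.measure_lt_top.ne

omit [TopologicalSpace Γ] [IsTopologicalGroup Γ] [T2Space Γ] [LocallyCompactSpace Γ]
  [BorelSpace Γ] [ν.IsHaarMeasure] [ν.Regular] [Group Γ] in
theorem integral_cond_eq {E : Type*} [NormedAddCommGroup E] [NormedSpace ℝ E] (φ : Γ → E) :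
    ∫ m, φ m ∂(cond ν F) = (ν.real F)⁻¹ • ∫ m in F, φ m ∂ν := by
  rw [ProbabilityTheory.cond, integral_smul_measure, ENNReal.toReal_inv]; rfl

omit [TopologicalSpace Γ] [T2Space Γ] [LocallyCompactSpace Γ] [BorelSpace Γ] [ν.IsHaarMeasure]
  [ν.Regular] [IsTopologicalGroup Γ] [Group Γ] in
theorem aestronglyMeasurable_cond {E : Type*} [TopologicalSpace E] {φ : Γ → E}
    (h : AEStronglyMeasurable φ (ν.restrict F)) : AEStronglyMeasurable φ (cond ν F) :=
  h.smul_measure _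

omit [T2Space Γ] in
theorem BddMeas.translate {E : Type*} [NormedAddCommGroup E] {φ : Γ → E} {M : ℝ}
    (hφ : BddMeas ν φ M) (a : Γ) : BddMeas ν (fun n => φ (a * n)) M :=
  ⟨by simpa using hφ.meas.translate a 1, fun n => hφ.bdd _⟩

omit [IsTopologicalGroup Γ] [T2Space Γ] [LocallyCompactSpace Γ] [BorelSpace Γ] [ν.Regular] in
theorem BddMeas.integrable {E : Type*} [NormedAddCommGroup E] {φ : Γ → E} {M : ℝ}
    (hφ : BddMeas ν φ M) (hF : IsAvgSet ν F) : Integrable φ (cond ν F) :=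
  have := hF.isProbabilityMeasure
  Integrable.of_bound (aestronglyMeasurable_cond (hφ.meas F hF.isCompact)) M
    (Eventually.of_forall hφ.bdd)

omit [IsTopologicalGroup Γ] [T2Space Γ] [LocallyCompactSpace Γ] [BorelSpace Γ] [ν.Regular] in
theorem norm_integral_cond_le {E : Type*} [NormedAddCommGroup E] [NormedSpace ℝ E] {φ : Γ → E}
    {M : ℝ} (hφ : ∀ n, ‖φ n‖ ≤ M) (hF : IsAvgSet ν F) : ‖∫ n, φ n ∂(cond ν F)‖ ≤ M := by
  have := hF.isProbabilityMeasure
  simpa using norm_integral_le_of_norm_le_const (Eventually.of_forall hφ) (μ := cond ν F)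

omit [LocallyCompactSpace Γ] [ν.Regular] in
theorem norm_integral_cond_sub_translate_le {E : Type*} [NormedAddCommGroup E] [NormedSpace ℝ E]
    {φ : Γ → E} {M : ℝ} (hφ : BddMeas ν φ M) (hF : IsAvgSet ν F) (l : Γ) {η : ℝ}
    (hη : ν.real ((l • F) ∆ F) ≤ η * ν.real F) :
    ‖∫ m, φ m ∂(cond ν F) - ∫ m, φ (l * m) ∂(cond ν F)‖ ≤ η * M := by
  have hM : 0 ≤ M := (norm_nonneg _).trans (hφ.bdd 1)
  have hl : IsCompact (l • F) := hF.isCompact.smul l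
  have h1 : ∫ m in F, φ (l * m) ∂ν = ∫ m in l • F, φ m ∂ν :=
    ((measurePreserving_mul_left ν l).setIntegral_image_emb
      (MeasurableEquiv.mulLeft l).measurableEmbedding φ F).symm
  have hint : ∀ S : Set Γ, IsCompact S → IntegrableOn φ S ν := fun S hS => by
    have : IsFiniteMeasure (ν.restrict S) := ⟨by simpa using hS.measure_lt_top⟩
    exact Integrable.of_bound (hφ.meas S hS) M (Eventually.of_forall hφ.bdd)
  have e1 := integral_inter_add_sdiff hl.measurableSet (hint F hF.isCompact)
  have e2 := integral_inter_add_sdiff hF.isCompact.measurableSet (hint _ hl)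
  rw [Set.inter_comm] at e2
  rw [integral_cond_eq, integral_cond_eq, h1, ← smul_sub, ← e1, ← e2, add_sub_add_left_eq_sub,
    norm_smul, norm_inv, Real.norm_eq_abs, abs_of_pos hF.real_pos,
    inv_mul_le_iff₀ hF.real_pos]
  have b1 : ‖∫ m in F \ (l • F), φ m ∂ν‖ ≤ M * ν.real (F \ (l • F)) :=
    norm_setIntegral_le_of_norm_le_const
      ((measure_mono Set.sdiff_subset).trans_lt hF.isCompact.measure_lt_top) fun m _ => hφ.bdd m
  have b2 : ‖∫ m in (l • F) \ F, φ m ∂ν‖ ≤ M * ν.real ((l • F) \ F) :=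
    norm_setIntegral_le_of_norm_le_const
      ((measure_mono Set.sdiff_subset).trans_lt hl.measure_lt_top) fun m _ => hφ.bdd m
  have e3 : ν.real ((l • F) ∆ F) = ν.real ((l • F) \ F) + ν.real (F \ (l • F)) := by
    rw [Set.symmDiff_def]
    exact measureReal_union disjoint_sdiff_sdiff
      (hF.isCompact.measurableSet.diff hl.measurableSet)
      ((measure_mono Set.sdiff_subset).trans_lt hl.measure_lt_top).ne
      ((measure_mono Set.sdiff_subset).trans_lt hF.isCompact.measure_lt_top).ne
  calc _ ≤ M * ν.real (F \ (l • F)) + M * ν.real ((l • F) \ F) :=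
        (norm_sub_le _ _).trans (add_le_add b1 b2)
    _ = M * ν.real ((l • F) ∆ F) := by rw [e3]; ring
    _ ≤ M * (η * ν.real F) := by gcongr
    _ = _ := by ring

variable [CompleteSpace H] [NormedSpace ℝ H] [IsScalarTower ℝ 𝕜 H]

local notation "⟪" x ", " y "⟫" => inner 𝕜 x y

/-- The average of a field of contractions, as an operator. -/
noncomputable def avgOp {W : Γ → H →L[𝕜] H} (hF : IsAvgSet ν F) (hW : IsContractionField ν W)
    (a : Γ) : H →ₗ[ℝ] H where
  toFun u := ∫ n, W (a * n) u ∂(cond ν F)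
  map_add' u v := by
    simp only [map_add]
    exact integral_add (((hW.bddMeas u).translate a).integrable hF)
      (((hW.bddMeas v).translate a).integrable hF)
  map_smul' c u := by
    simp only [RingHom.id_apply, RCLike.real_smul_eq_coe_smul (K := 𝕜), map_smul]
    exact integral_smul _ _

omit [T2Space Γ] [CompleteSpace H] in
theorem avgOp_apply {W : Γ → H →L[𝕜] H} (hF : IsAvgSet ν F) (hW : IsContractionField ν W)
    (a : Γ) (u : H) : avgOp hF hW a u = ∫ n, W (a * n) u ∂(cond ν F) := rfl

omit [T2Space Γ] [CompleteSpace H] in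
theorem norm_avgOp_le {W : Γ → H →L[𝕜] H} (hF : IsAvgSet ν F) (hW : IsContractionField ν W)
    (a : Γ) (u : H) : ‖avgOp hF hW a u‖ ≤ ‖u‖ :=
  norm_integral_cond_le (fun _ => hW.norm_apply_le _ u) hF

omit [T2Space Γ] in
theorem inner_avgOp {W : Γ → H →L[𝕜] H} (hF : IsAvgSet ν F) (hW : IsContractionField ν W)
    (a : Γ) (v u : H) : ⟪v, avgOp hF hW a u⟫ = ∫ n, ⟪v, W (a * n) u⟫ ∂(cond ν F) :=
  (integral_inner (((hW.bddMeas u).translate a).integrable hF) v).symm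

omit [T2Space Γ] in
theorem inner_avgOp_star {W W' : Γ → H →L[𝕜] H} (hF : IsAvgSet ν F) (hW : IsContractionField ν W)
    (hW' : IsContractionField ν W') (hWW' : ∀ n, W' n = star (W n)) (a : Γ) (u h : H) :
    ⟪u, avgOp hF hW' a h⟫ = ⟪avgOp hF hW a u, h⟫ := by
  rw [← inner_conj_symm (avgOp hF hW a u), inner_avgOp, inner_avgOp, ← integral_conj]
  congr 1 with n
  rw [inner_conj_symm, hWW', ContinuousLinearMap.star_eq_adjoint,
    ContinuousLinearMap.adjoint_inner_right]

omit [T2Space Γ] in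
theorem avgOp_mem {W : Γ → H →L[𝕜] H} (hF : IsAvgSet ν F) (hW : IsContractionField ν W)
    (a : Γ) {D : Set H} (hD : Convex ℝ D) (hDc : IsClosed D) {u : H} (hu : ∀ n, W n u ∈ D) :
    avgOp hF hW a u ∈ D := by
  have := hF.isProbabilityMeasure
  exact hD.integral_mem hDc (Eventually.of_forall fun _ => hu _)
    (((hW.bddMeas u).translate a).integrable hF)

/-- Almost invariance of `F` under `a • E` allows `m` to be replaced by `a n m` in the inner average
at a cost of `η ‖h‖`; then the averages over `n` and `m` are interchanged. The first claim is what
integrability of the resulting function of `m` rests on. -/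
theorem inner_avgOp_avgOp {W W' : Γ → H →L[𝕜] H} (hE : IsAvgSet ν E) (hF : IsAvgSet ν F)
    (hW : IsContractionField ν W) (hW' : IsContractionField ν W') (hWW' : ∀ n, W' n = star (W n))
    (a b : Γ) (h v : H) {η : ℝ} (hη : ∀ l ∈ a • E, ν.real ((l • F) ∆ F) ≤ η * ν.real F) :
    AEStronglyMeasurable
      (fun m => ⟪v, ∫ n, W (a * n) (W' (b * (a * n) * m) h) ∂(cond ν E)⟫) (cond ν F) ∧
    ‖⟪v, avgOp hE hW a (avgOp hF hW' b h)⟫ -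
      ∫ m, ⟪v, ∫ n, W (a * n) (W' (b * (a * n) * m) h) ∂(cond ν E)⟫ ∂(cond ν F)‖ ≤
        η * (‖v‖ * ‖h‖) := by
  have hEp := hE.isProbabilityMeasure
  have hFp := hF.isProbabilityMeasure
  set ψ : Γ → H := fun n => W' (a * n) v with hψ
  set φ : Γ → H := fun m => W' (b * a * m) h with hφ
  have hψb : BddMeas ν ψ ‖v‖ := (hW'.bddMeas v).translate a
  have hφb : BddMeas ν φ ‖h‖ := (hW'.bddMeas h).translate (b * a)
  have hinn : ∀ n x, ⟪v, W (a * n) x⟫ = ⟪ψ n, x⟫ := fun n x => by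
    rw [hψ]
    simp only
    rw [hWW', ContinuousLinearMap.star_eq_adjoint, ContinuousLinearMap.adjoint_inner_left]
  have hφe : ∀ n m, W' (b * (a * n) * m) h = φ (n * m) := fun n m => by
    simp only [hφ, mul_assoc]
  have hinner : ∀ m, ⟪v, ∫ n, W (a * n) (W' (b * (a * n) * m) h) ∂(cond ν E)⟫ =
      ∫ n, ⟪ψ n, φ (n * m)⟫ ∂(cond ν E) := by
    intro m
    have hb : BddMeas ν (fun n => W (a * n) (W' (b * (a * n) * m) h)) ‖h‖ := by
      refine ⟨?_, fun n => (hW.norm_apply_le _ _).trans (hW'.norm_apply_le _ _)⟩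
      have h1 : CompactlyAEMeasurable ν fun n => W' (b * (a * n) * m) h := by
        simpa only [mul_assoc] using (hW'.meas h).translate (b * a) m
      refine CompactlyAEMeasurable.apply (T := fun n => W (a * n)) (fun w => ?_) h1
      simpa using (hW.meas w).translate a 1
    rw [← integral_inner (hb.integrable hE)]
    simp only [hinn, hφe]
  obtain ⟨sw0, sw1, sw2⟩ := integral_swap_translate (𝕜 := 𝕜) ν hE.isCompact hF.isCompact
    (hψb.meas E hE.isCompact) hψb.bdd hφb.meas hφb.bdd
  have swap : ∫ m, ∫ n, ⟪ψ n, φ (n * m)⟫ ∂(cond ν E) ∂(cond ν F) =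
      ∫ n, ∫ m, ⟪ψ n, φ (n * m)⟫ ∂(cond ν F) ∂(cond ν E) := by
    simp only [integral_cond_eq, integral_smul]
    rw [sw2, smul_comm]
  constructor
  · simp only [hinner]
    refine aestronglyMeasurable_cond ?_
    simp only [integral_cond_eq]
    exact sw1.const_smul _
  · simp only [hinner]
    rw [swap, inner_avgOp]
    simp only [hinn]
    have e1 : ∀ n, ∫ m, ⟪ψ n, φ (n * m)⟫ ∂(cond ν F) = ⟪ψ n, ∫ m, φ (n * m) ∂(cond ν F)⟫ :=
      fun n => integral_inner ((hφb.translate n).integrable hF) _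
    simp only [e1]
    set σ := avgOp hF hW' b h with hσ
    have hσn : ∀ n ∈ E, ‖σ - ∫ m, φ (n * m) ∂(cond ν F)‖ ≤ η * ‖h‖ := by
      intro n hn
      have h1 := norm_integral_cond_sub_translate_le ((hW'.bddMeas h).translate b) hF (a * n)
        (hη _ ⟨n, hn, rfl⟩)
      simpa only [hφ, hσ, avgOp_apply, mul_assoc] using h1
    have hm1 : AEStronglyMeasurable (fun n => ⟪ψ n, σ⟫) (cond ν E) :=
      (aestronglyMeasurable_cond (hψb.meas E hE.isCompact)).inner aestronglyMeasurable_const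
    have hi1 : Integrable (fun n => ⟪ψ n, σ⟫) (cond ν E) :=
      Integrable.of_bound hm1 (‖v‖ * ‖σ‖) (Eventually.of_forall fun n =>
        (norm_inner_le_norm _ _).trans (by gcongr; exact hψb.bdd n))
    have hae : ∀ᵐ n ∂(cond ν E), n ∈ E := ae_cond_mem hE.isCompact.measurableSet
    have hi2 : Integrable (fun n => ⟪ψ n, ∫ m, φ (n * m) ∂(cond ν F)⟫) (cond ν E) := by
      refine Integrable.of_bound ?_ (‖v‖ * ‖h‖) (Eventually.of_forall fun n =>
        (norm_inner_le_norm _ _).trans ?_)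
      · simp only [← e1]
        refine aestronglyMeasurable_cond ?_
        simp only [integral_cond_eq]
        exact sw0.const_smul _
      · gcongr
        · exact hψb.bdd n
        · exact norm_integral_cond_le (fun m => hφb.bdd _) hF
    rw [← integral_sub hi1 hi2]
    have := norm_integral_le_of_norm_le_const (μ := cond ν E) (C := η * (‖v‖ * ‖h‖))
      (f := fun n => ⟪ψ n, σ⟫ - ⟪ψ n, ∫ m, φ (n * m) ∂(cond ν F)⟫) ?_
    · simpa using this
    · filter_upwards [hae] with n hn
      rw [← inner_sub_right]
      calc _ ≤ ‖ψ n‖ * ‖σ - ∫ m, φ (n * m) ∂(cond ν F)‖ := norm_inner_le_norm _ _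
        _ ≤ ‖v‖ * (η * ‖h‖) := by
          gcongr
          · exact hψb.bdd n
          · exact hσn n hn
        _ = _ := by ring

end Averages

/-! ### Multiplier systems and the convergence theorem along sequences -/

section Multipliers

open ProbabilityTheory

variable {𝕜 H G : Type*} [RCLike 𝕜] [NormedAddCommGroup H] [InnerProductSpace 𝕜 H]
  [CompleteSpace H] [NormedSpace ℝ H] [IsScalarTower ℝ 𝕜 H] [Group G]

/-- A commuting set `B` of contractions, invariant under a unitary representation `ρ`, together
with an invariant vector `v₀` whose orbit under `B` is closed and convex. -/
structure MultiplierSystem (ρ : G →* (H →L[𝕜] H)) (B : Set (H →L[𝕜] H)) (v₀ : H) : Prop where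
  star_rep : ∀ g, star (ρ g) = ρ g⁻¹
  fixed : ∀ g, ρ g v₀ = v₀
  norm_vec : ‖v₀‖ ≤ 1
  norm_le : ∀ f ∈ B, ‖f‖ ≤ 1
  one_mem : 1 ∈ B
  mul_mem : ∀ f ∈ B, ∀ f' ∈ B, f * f' ∈ B
  star_mem : ∀ f ∈ B, star f ∈ B
  neg_mem : ∀ f ∈ B, -f ∈ B
  conj_mem : ∀ g, ∀ f ∈ B, ρ g * f * ρ g⁻¹ ∈ B
  comm : ∀ f ∈ B, ∀ f' ∈ B, f * f' = f' * f
  closed : IsClosed ((fun f : H →L[𝕜] H => f v₀) '' B)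
  convex : Convex ℝ ((fun f : H →L[𝕜] H => f v₀) '' B)

variable {ρ : G →* (H →L[𝕜] H)} {B : Set (H →L[𝕜] H)} {v₀ : H}

omit [NormedSpace ℝ H] [IsScalarTower ℝ 𝕜 H] in
theorem norm_rep_le (h : ∀ g, star (ρ g) = ρ g⁻¹) (g : G) : ‖ρ g‖ ≤ 1 := by
  have h1 : ‖ρ g‖ * ‖ρ g‖ = ‖(1 : H →L[𝕜] H)‖ := by
    rw [← CStarRing.norm_star_mul_self, h, ← map_mul, inv_mul_cancel, map_one]
  have h2 : ‖(1 : H →L[𝕜] H)‖ ≤ 1 := ContinuousLinearMap.norm_id_le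
  nlinarith [norm_nonneg (ρ g)]

variable {Γ : Type*} [Group Γ] [TopologicalSpace Γ] [IsTopologicalGroup Γ] [MeasurableSpace Γ]
  [T2Space Γ] [LocallyCompactSpace Γ] [BorelSpace Γ]

/-- Product of the conjugates of multipliers along a list of families. -/
def prodOp (ρ : G →* (H →L[𝕜] H)) (Q : List ((ℕ → Γ → G) × (ℕ → H →L[𝕜] H))) (x : ℕ) (n : Γ) :
    H →L[𝕜] H :=
  (Q.map fun p => ρ (p.1 x n) * p.2 x * ρ (p.1 x n)⁻¹).prod

/-- The adjoint of a list of families with multipliers. -/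
noncomputable def starList (Q : List ((ℕ → Γ → G) × (ℕ → H →L[𝕜] H))) :
    List ((ℕ → Γ → G) × (ℕ → H →L[𝕜] H)) :=
  (Q.map fun p => (p.1, fun x => star (p.2 x))).reverse

/-- A family of measurable mappings into the group of unitary operators. -/
def IsMeasFam (ρ : G →* (H →L[𝕜] H)) (ν : Measure Γ) (g : ℕ → Γ → G) : Prop :=
  ∀ x v, CompactlyAEMeasurable ν (fun n => ρ (g x n) v) ∧
    CompactlyAEMeasurable ν (fun n => ρ (g x n)⁻¹ v)

/-- A list of measurable families and multipliers from `B`. -/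
def IsAdmissible (ρ : G →* (H →L[𝕜] H)) (B : Set (H →L[𝕜] H)) (ν : Measure Γ)
    (Q : List ((ℕ → Γ → G) × (ℕ → H →L[𝕜] H))) : Prop :=
  ∀ p ∈ Q, IsMeasFam ρ ν p.1 ∧ ∀ x, p.2 x ∈ B

/-- A sequence of averaging sets with shifts that is asymptotically invariant under each of its
members. -/
structure IsFolnerSeq (ν : Measure Γ) (a : ℕ → Γ) (F : ℕ → Set Γ) : Prop where
  avg : ∀ k, IsAvgSet ν (F k)
  asymp : ∀ k, ∀ ε : ℝ, 0 < ε → ∀ᶠ N in atTop, ∀ l ∈ a k • F k,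
    ν.real ((l • F N) ∆ F N) ≤ ε * ν.real (F N)

/-- Convergence of all averages with mappings from `S` along the sequence of averaging sets. -/
def ConvergesOn (ρ : G →* (H →L[𝕜] H)) (B : Set (H →L[𝕜] H)) (v₀ : H) (ν : Measure Γ) (a : ℕ → Γ)
    (F : ℕ → Set Γ) (S : Set (ℕ → Γ → G)) : Prop :=
  ∀ Q : List ((ℕ → Γ → G) × (ℕ → H →L[𝕜] H)), (∀ p ∈ Q, p.1 ∈ insert 1 S) →
    IsAdmissible ρ B ν Q → ∀ ε : ℝ, 0 < ε → ∃ N, ∀ k ≥ N, ∀ l ≥ N, ∀ᶠ x in natUltra,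
      ‖∫ n, prodOp ρ Q x (a k * n) v₀ ∂(cond ν (F k)) -
        ∫ n, prodOp ρ Q x (a l * n) v₀ ∂(cond ν (F l))‖ ≤ ε

/-! ### Algebra of products of conjugated multipliers. -/

section Algebra

theorem MultiplierSystem.prodOp_mem (h : MultiplierSystem ρ B v₀)
    {Q : List ((ℕ → Γ → G) × (ℕ → H →L[𝕜] H))} (hQ : ∀ p ∈ Q, ∀ x, p.2 x ∈ B) (x : ℕ) (n : Γ) :
    prodOp ρ Q x n ∈ B := by
  induction Q with
  | nil => exact h.one_mem
  | cons p Q ih =>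
    rw [prodOp, List.map_cons, List.prod_cons]
    exact h.mul_mem _ (h.conj_mem _ _ (hQ p (by simp) x)) _
      (ih fun q hq => hQ q (List.mem_cons_of_mem _ hq))

theorem MultiplierSystem.star_prodOp (h : MultiplierSystem ρ B v₀)
    (Q : List ((ℕ → Γ → G) × (ℕ → H →L[𝕜] H))) (x : ℕ) (n : Γ) :
    prodOp ρ (starList Q) x n = star (prodOp ρ Q x n) := by
  induction Q with
  | nil => simp [prodOp, starList]
  | cons p Q ih =>
    simp only [prodOp, starList] at ih ⊢
    rw [List.map_cons, List.reverse_cons, List.map_append, List.prod_append, ih,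
      List.map_cons (l := Q), List.prod_cons, star_mul]
    simp [h.star_rep, mul_assoc]

theorem prodOp_append (Q Q' : List ((ℕ → Γ → G) × (ℕ → H →L[𝕜] H))) (x : ℕ) (n : Γ) :
    prodOp ρ (Q ++ Q') x n = prodOp ρ Q x n * prodOp ρ Q' x n := by
  simp [prodOp]

/-- Reduction by `g` multiplies every translated mapping on the left by the same element `c`, so the
inner factors `ρ c⁻¹ ρ c` cancel and one outer conjugation remains. -/
theorem prodOp_reduction (Q : List ((ℕ → Γ → G) × (ℕ → H →L[𝕜] H))) (a b : ℕ → Γ)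
    (g : ℕ → Γ → G) (x : ℕ) (n : Γ) :
    prodOp ρ (Q.map fun p => (reduction (translate a b) g p.1, p.2)) x n =
      ρ (g x n * (g x (a x * n * b x))⁻¹) * prodOp ρ Q x (a x * n * b x) *
        ρ (g x n * (g x (a x * n * b x))⁻¹)⁻¹ := by
  set c := g x n * (g x (a x * n * b x))⁻¹ with hc
  induction Q with
  | nil =>
    simp only [prodOp, List.map_nil, List.prod_nil, mul_one]
    rw [← ρ.map_mul, mul_inv_cancel, ρ.map_one]
  | cons p Q ih =>
    simp only [prodOp, List.map_cons, List.prod_cons] at ih ⊢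
    rw [ih]
    have e : reduction (translate a b) g p.1 x n = c * p.1 x (a x * n * b x) := rfl
    have e1 : ρ c⁻¹ * ρ c = 1 := by rw [← ρ.map_mul, inv_mul_cancel, ρ.map_one]
    have e2 : ρ (c * p.1 x (a x * n * b x))⁻¹ = ρ (p.1 x (a x * n * b x))⁻¹ * ρ c⁻¹ := by
      rw [← map_mul, mul_inv_rev]
    rw [e, e2, ρ.map_mul c]
    generalize (List.map (fun p : (ℕ → Γ → G) × (ℕ → H →L[𝕜] H) =>
      ρ (p.1 x (a x * n * b x)) * p.2 x * ρ (p.1 x (a x * n * b x))⁻¹) Q).prod = P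
    generalize ρ (p.1 x (a x * n * b x)) = V
    generalize ρ (p.1 x (a x * n * b x))⁻¹ = V'
    calc _ = ρ c * V * p.2 x * V' * (ρ c⁻¹ * ρ c) * P * ρ c⁻¹ := by simp only [mul_assoc]
      _ = _ := by rw [e1, mul_one]; simp only [mul_assoc]

/-- By commutativity all factors carrying `g` can be moved to the end and merged into one conjugated
multiplier. -/
theorem MultiplierSystem.factor (h : MultiplierSystem ρ B v₀) {ν : Measure Γ} (g : ℕ → Γ → G)
    {S : Set (ℕ → Γ → G)} (Q : List ((ℕ → Γ → G) × (ℕ → H →L[𝕜] H)))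
    (hQS : ∀ p ∈ Q, p.1 ∈ insert 1 (insert g S)) (hQ : IsAdmissible ρ B ν Q) :
    ∃ (Q' : List ((ℕ → Γ → G) × (ℕ → H →L[𝕜] H))) (f : ℕ → H →L[𝕜] H),
      (∀ p ∈ Q', p.1 ∈ insert 1 S) ∧ IsAdmissible ρ B ν Q' ∧ (∀ x, f x ∈ B) ∧
      ∀ x n, prodOp ρ Q x n = prodOp ρ Q' x n * (ρ (g x n) * f x * ρ (g x n)⁻¹) := by
  induction Q with
  | nil => exact ⟨[], fun _ => 1, by simp, by simp [IsAdmissible], fun _ => h.one_mem,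
      fun x n => by simp [prodOp, ← map_mul]⟩
  | cons p Q ih =>
    obtain ⟨Q', f, h1, h2, h3, h4⟩ := ih (fun q hq => hQS q (List.mem_cons_of_mem _ hq))
      (fun q hq => hQ q (List.mem_cons_of_mem _ hq))
    have hp := hQ p (by simp)
    have cons : ∀ q : (ℕ → Γ → G) × (ℕ → H →L[𝕜] H), ∀ (Q : List _) (x : ℕ) (n : Γ),
        prodOp ρ (q :: Q) x n = (ρ (q.1 x n) * q.2 x * ρ (q.1 x n)⁻¹) * prodOp ρ Q x n :=
      fun q Q x n => by simp [prodOp]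
    by_cases hpg : p.1 = g
    · refine ⟨Q', fun x => p.2 x * f x, h1, h2, fun x => h.mul_mem _ (hp.2 x) _ (h3 x),
        fun x n => ?_⟩
      rw [cons, h4, hpg, ← mul_assoc, h.comm _ (h.conj_mem _ _ (hp.2 x)) _
        (h.prodOp_mem (fun q hq => (h2 q hq).2) x n), mul_assoc]
      congr 1
      have e1 : ρ (g x n)⁻¹ * ρ (g x n) = 1 := by rw [← ρ.map_mul, inv_mul_cancel, ρ.map_one]
      calc _ = ρ (g x n) * p.2 x * (ρ (g x n)⁻¹ * ρ (g x n)) * f x * ρ (g x n)⁻¹ := by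
            simp only [mul_assoc]
        _ = _ := by rw [e1, mul_one]; simp only [mul_assoc]
    · refine ⟨p :: Q', f, ?_, ?_, h3, fun x n => ?_⟩
      · intro q hq
        rcases List.mem_cons.1 hq with rfl | hq
        · rcases hQS q (by simp) with h | h | h
          · exact Or.inl h
          · exact absurd h hpg
          · exact Or.inr h
        · exact h1 q hq
      · intro q hq
        rcases List.mem_cons.1 hq with rfl | hq
        · exact hp
        · exact h2 q hq
      · rw [cons, cons, h4]; simp only [mul_assoc]

end Algebra

/-! ### Measurability of the operator fields. -/

section Measurability

variable {ν : Measure Γ} [ν.IsHaarMeasure] [ν.Regular]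

omit [T2Space Γ] [LocallyCompactSpace Γ] [BorelSpace Γ] [ν.IsHaarMeasure] [ν.Regular] in
theorem MultiplierSystem.isContractionField_rep (h : MultiplierSystem ρ B v₀)
    {g : ℕ → Γ → G} (hg : IsMeasFam ρ ν g) (x : ℕ) :
    IsContractionField ν (fun n => ρ (g x n)) ∧ IsContractionField ν (fun n => ρ (g x n)⁻¹) :=
  ⟨⟨fun v => (hg x v).1, fun _ => norm_rep_le h.star_rep _⟩,
    ⟨fun v => (hg x v).2, fun _ => norm_rep_le h.star_rep _⟩⟩

omit [T2Space Γ] [LocallyCompactSpace Γ] [BorelSpace Γ] [ν.IsHaarMeasure] [ν.Regular] in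
theorem MultiplierSystem.isContractionField_prodOp (h : MultiplierSystem ρ B v₀)
    {Q : List ((ℕ → Γ → G) × (ℕ → H →L[𝕜] H))} (hQ : IsAdmissible ρ B ν Q) (x : ℕ) :
    IsContractionField ν (prodOp ρ Q x) := by
  induction Q with
  | nil =>
    have e : prodOp ρ ([] : List ((ℕ → Γ → G) × (ℕ → H →L[𝕜] H))) x = fun _ => 1 := by
      funext n; simp [prodOp]
    rw [e]
    exact isContractionField_const ν (h.norm_le _ h.one_mem)
  | cons p Q ih =>
    have e : prodOp ρ (p :: Q) x =
        fun n => (ρ (p.1 x n) * p.2 x * ρ (p.1 x n)⁻¹) * prodOp ρ Q x n := by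
      funext n; simp [prodOp]
    obtain ⟨hp1, hp2⟩ := hQ p (by simp)
    obtain ⟨r1, r2⟩ := h.isContractionField_rep hp1 x
    rw [e]
    exact ((r1.mul (isContractionField_const ν (h.norm_le _ (hp2 x)))).mul r2).mul
      (ih fun q hq => hQ q (List.mem_cons_of_mem _ hq))

omit [IsTopologicalGroup Γ] [T2Space Γ] [LocallyCompactSpace Γ] [BorelSpace Γ]
  [ν.IsHaarMeasure] [ν.Regular] in
theorem MultiplierSystem.isAdmissible_starList (h : MultiplierSystem ρ B v₀)
    {Q : List ((ℕ → Γ → G) × (ℕ → H →L[𝕜] H))} (hQ : IsAdmissible ρ B ν Q) :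
    IsAdmissible ρ B ν (starList Q) := by
  intro p hp
  simp only [starList, List.mem_reverse, List.mem_map] at hp
  obtain ⟨q, hq, rfl⟩ := hp
  exact ⟨(hQ q hq).1, fun x => h.star_mem _ ((hQ q hq).2 x)⟩

omit [T2Space Γ] in
theorem MultiplierSystem.isMeasFam_reduction (h : MultiplierSystem ρ B v₀) {g k : ℕ → Γ → G}
    (hg : IsMeasFam ρ ν g) (hk : IsMeasFam ρ ν k) (a b : ℕ → Γ) :
    IsMeasFam ρ ν (reduction (translate a b) g k) := by
  intro x v
  have tr : ∀ {f : ℕ → Γ → G}, IsMeasFam ρ ν f →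
      IsContractionField ν (fun n => ρ (f x (a x * n * b x))) ∧
      IsContractionField ν (fun n => ρ (f x (a x * n * b x))⁻¹) := fun hf =>
    ⟨⟨fun v => (hf x v).1.translate (a x) (b x), fun _ => norm_rep_le h.star_rep _⟩,
      ⟨fun v => (hf x v).2.translate (a x) (b x), fun _ => norm_rep_le h.star_rep _⟩⟩
  obtain ⟨r1, r2⟩ := h.isContractionField_rep hg x
  have e1 : (fun n => ρ (reduction (translate a b) g k x n) v) = fun n =>
      (ρ (g x n) * ρ (g x (a x * n * b x))⁻¹ * ρ (k x (a x * n * b x))) v := by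
    funext n; rw [← map_mul, ← map_mul]; rfl
  have e2 : (fun n => ρ (reduction (translate a b) g k x n)⁻¹ v) = fun n =>
      (ρ (k x (a x * n * b x))⁻¹ * (ρ (g x (a x * n * b x)) * ρ (g x n)⁻¹)) v := by
    funext n
    rw [← map_mul, ← map_mul]
    have : (reduction (translate a b) g k x n)⁻¹ =
        (k x (a x * n * b x))⁻¹ * (g x (a x * n * b x) * (g x n)⁻¹) := by
      change (g x n * (g x (a x * n * b x))⁻¹ * k x (a x * n * b x))⁻¹ = _
      group
    rw [this]
  rw [e1, e2]
  exact ⟨((r1.mul (tr hg).2).mul (tr hk).1).meas v, ((tr hk).2.mul ((tr hg).1.mul r2)).meas v⟩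

omit [IsTopologicalGroup Γ] [T2Space Γ] [LocallyCompactSpace Γ] [BorelSpace Γ]
  [ν.IsHaarMeasure] [ν.Regular] [CompleteSpace H] in
theorem isMeasFam_one : IsMeasFam ρ ν 1 := fun _ _ =>
  ⟨fun _ _ => by simpa using aestronglyMeasurable_const,
    fun _ _ => by simpa using aestronglyMeasurable_const⟩

end Measurability

end Multipliers

/-! ### Convergence along sequences of averaging sets -/

section Reducible

open ProbabilityTheory

variable {𝕜 H G : Type*} [RCLike 𝕜] [NormedAddCommGroup H] [InnerProductSpace 𝕜 H]
  [CompleteSpace H] [NormedSpace ℝ H] [IsScalarTower ℝ 𝕜 H] [Group G]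
  {ρ : G →* (H →L[𝕜] H)} {B : Set (H →L[𝕜] H)} {v₀ : H}
  {Γ : Type*} [Group Γ] [TopologicalSpace Γ] [IsTopologicalGroup Γ] [MeasurableSpace Γ]
  [T2Space Γ] [LocallyCompactSpace Γ] [BorelSpace Γ]
  {ν : Measure Γ} [ν.IsHaarMeasure] [ν.Regular] {a : ℕ → Γ} {F : ℕ → Set Γ}

theorem MultiplierSystem.norm_apply_vec_le (h : MultiplierSystem ρ B v₀) {f : H →L[𝕜] H}
    (hf : f ∈ B) : ‖f v₀‖ ≤ 1 := by
  have := f.le_of_opNorm_le (h.norm_le f hf) v₀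
  linarith [h.norm_vec]

/-- Appending to a list its reduced adjoint realises the composition of a field of operators with
a translate of the adjoint field. -/
theorem MultiplierSystem.prodOp_append_reduction_apply (h : MultiplierSystem ρ B v₀)
    (Q : List ((ℕ → Γ → G) × (ℕ → H →L[𝕜] H))) (f : ℕ → H →L[𝕜] H) (g : ℕ → Γ → G)
    (b c : ℕ → Γ) (x : ℕ) (n : Γ) :
    prodOp ρ (Q ++ (starList Q ++ [((1 : ℕ → Γ → G), f)]).map
        fun p => (reduction (translate b c) g p.1, p.2)) x n v₀ =
      (prodOp ρ Q x n * ρ (g x n)) ((ρ (g x (b x * n * c x))⁻¹ *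
        prodOp ρ (starList Q) x (b x * n * c x)) (f x v₀)) := by
  have e1 : ∀ m : Γ, prodOp ρ [((1 : ℕ → Γ → G), f)] x m = f x := fun m => by simp [prodOp]
  rw [prodOp_append, prodOp_reduction, prodOp_append, e1, ρ.map_mul]
  simp only [mul_apply_eq_comp, h.fixed]

/-- Were the family not Cauchy, `‖T_k σ - T_l σ‖²` would be large for infinitely many pairs of
scales. By `inner_avgOp_avgOp` it is nearly a mean over `m` of pairings with averages `A k x m`.
Some `m = y x` is bad for infinitely many of the pairs, but for this fixed `y` the averages are
those of a reduced system, which converge by `hS`. -/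
theorem MultiplierSystem.cauchyFam_avgOp_star (h : MultiplierSystem ρ B v₀)
    (hF : IsFolnerSeq ν a F) {g : ℕ → Γ → G} {S : Set (ℕ → Γ → G)}
    (hS : ∀ b c : ℕ → Γ,
      ConvergesOn ρ B v₀ ν a F (S ∪ reduction (translate b c) g '' insert 1 S))
    (hg : IsMeasFam ρ ν g) {Q : List ((ℕ → Γ → G) × (ℕ → H →L[𝕜] H))}
    (hQS : ∀ p ∈ Q, p.1 ∈ insert 1 S) (hQ : IsAdmissible ρ B ν Q)
    {W W' : ℕ → Γ → H →L[𝕜] H} (hW : ∀ x, IsContractionField ν (W x))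
    (hW' : ∀ x, IsContractionField ν (W' x)) (hWW' : ∀ x n, W' x n = star (W x n))
    (eW : ∀ x n, W x n = prodOp ρ Q x n * ρ (g x n))
    (eW' : ∀ x n, W' x n = ρ (g x n)⁻¹ * prodOp ρ (starList Q) x n)
    {r : ℕ → ℕ} (hr : Tendsto r natUltra atTop) {f : ℕ → H →L[𝕜] H} (hf : ∀ x, f x ∈ B) :
    CauchyFam (fun k x => avgOp (hF.avg k) (hW x) (a k))
      fun x => avgOp (hF.avg (r x)) (hW' x) (a (r x)) (f x v₀) := by
  intro ε hε
  by_contra! hcon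
  choose k hk l hl hkl using hcon
  set T : ℕ → ℕ → H →ₗ[ℝ] H := fun k x => avgOp (hF.avg k) (hW x) (a k) with hT
  set u : ℕ → H := fun x => f x v₀ with hu
  set σ : ℕ → H := fun x => avgOp (hF.avg (r x)) (hW' x) (a (r x)) (u x) with hσ
  set v : ℕ → ℕ → H := fun i x => T (k i) x (σ x) - T (l i) x (σ x) with hv
  set A : ℕ → ℕ → Γ → H := fun k x m =>
    ∫ n, W x (a k * n) (W' x (a (r x) * (a k * n) * m) (u x)) ∂(cond ν (F k)) with hA
  have hu1 : ∀ x, ‖u x‖ ≤ 1 := fun x => h.norm_apply_vec_le (hf x)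
  have hσ1 : ∀ x, ‖σ x‖ ≤ 1 := fun x => (norm_avgOp_le _ _ _ _).trans (hu1 x)
  have hv2 : ∀ i x, ‖v i x‖ ≤ 2 := fun i x => by
    have h1 : ‖T (k i) x (σ x)‖ ≤ 1 := (norm_avgOp_le _ _ _ _).trans (hσ1 x)
    have h2 : ‖T (l i) x (σ x)‖ ≤ 1 := (norm_avgOp_le _ _ _ _).trans (hσ1 x)
    exact (norm_sub_le _ _).trans (by linarith)
  have hA1 : ∀ k x m, ‖A k x m‖ ≤ 1 := fun k x m =>
    norm_integral_cond_le (fun n => ((hW x).norm_apply_le _ _).trans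
      (((hW' x).norm_apply_le _ _).trans (hu1 x))) (hF.avg k)
  have hκ : ∀ x, IsProbabilityMeasure (cond ν (F (r x))) :=
    fun x => (hF.avg (r x)).isProbabilityMeasure
  set b : ℕ → ℕ → Γ → ℝ := fun i x m =>
    RCLike.re (inner 𝕜 (v i x) (A (k i) x m) - inner 𝕜 (v i x) (A (l i) x m)) with hb
  -- Here `‖v i x‖² > 4c`, and two interchange errors of size `c` leave a mean of `b` of at least
  -- `2c`. As `|b| ≤ 4`, the set `{c < b}` has measure at least `c / 4`.
  set c : ℝ := ε ^ 2 / 4 with hc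
  have hc0 : 0 < c := by positivity
  have swap : ∀ k i, ∀ᶠ x in natUltra,
      Integrable (fun m => inner 𝕜 (v i x) (A k x m)) (cond ν (F (r x))) ∧
      ‖inner 𝕜 (v i x) (T k x (σ x)) - ∫ m, inner 𝕜 (v i x) (A k x m) ∂(cond ν (F (r x)))‖ ≤
        c := by
    intro k i
    filter_upwards [hr.eventually (hF.asymp k (c / 2) (by positivity))] with x hx
    obtain ⟨h1, h2⟩ := inner_avgOp_avgOp (hF.avg k) (hF.avg (r x)) (hW x) (hW' x) (hWW' x) (a k)
      (a (r x)) (u x) (v i x) hx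
    refine ⟨Integrable.of_bound h1 2 (Eventually.of_forall fun m => ?_), h2.trans ?_⟩
    · exact (norm_inner_le_norm _ _).trans
        ((mul_le_mul (hv2 i x) (hA1 k x m) (norm_nonneg _) zero_le_two).trans (by norm_num))
    · calc c / 2 * (‖v i x‖ * ‖u x‖) ≤ c / 2 * (2 * 1) := by
            gcongr
            · exact hv2 i x
            · exact hu1 x
        _ = c := by ring
  have good : ∀ i, ∀ᶠ x in natUltra, ∃ E, MeasurableSet E ∧ E ⊆ {m | c < b i x m} ∧
      c / 4 ≤ (cond ν (F (r x))).real E := by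
    intro i
    filter_upwards [hkl i, swap (k i) i, swap (l i) i] with x h1 ⟨h2, h3⟩ ⟨h4, h5⟩
    have := hκ x
    refine exists_measurable_subset_real_ge (M := 4) ((h2.sub h4).re.aestronglyMeasurable)
      (by norm_num) (fun m => ?_) hc0.le ?_
    · refine (RCLike.abs_re_le_norm _).trans ((norm_sub_le _ _).trans ?_)
      have e1 : ∀ k, ‖inner 𝕜 (v i x) (A k x m)‖ ≤ 2 := fun k =>
        (norm_inner_le_norm _ _).trans
          ((mul_le_mul (hv2 i x) (hA1 k x m) (norm_nonneg _) zero_le_two).trans (by norm_num))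
      linarith [e1 (k i), e1 (l i)]
    · rw [integral_re (h2.sub h4), integral_sub' h2 h4]
      have e1 : inner 𝕜 (v i x) (T (k i) x (σ x)) - inner 𝕜 (v i x) (T (l i) x (σ x)) =
          ((‖v i x‖ ^ 2 : ℝ) : 𝕜) := by
        rw [← inner_sub_right, inner_self_eq_norm_sq_to_K]; norm_cast
      have e2 := congrArg RCLike.re e1
      rw [RCLike.ofReal_re, map_sub] at e2
      have e3 := (RCLike.abs_re_le_norm _).trans h3
      have e4 := (RCLike.abs_re_le_norm _).trans h5
      rw [map_sub, abs_le] at e3 e4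
      have e5 : ε ^ 2 ≤ ‖v i x‖ ^ 2 := by
        have : ε < ‖v i x‖ := h1
        gcongr
      rw [map_sub]
      linarith [e3.2, e4.1]
  -- The sets must be measurable for every `x`, so the empty set is used at the exceptional `x`.
  have sets : ∀ i x, ∃ E : Set Γ, MeasurableSet E ∧
      ((∃ E, MeasurableSet E ∧ E ⊆ {m | c < b i x m} ∧ c / 4 ≤ (cond ν (F (r x))).real E) →
        E ⊆ {m | c < b i x m} ∧ c / 4 ≤ (cond ν (F (r x))).real E) := fun i x => by
    by_cases hE : ∃ E, MeasurableSet E ∧ E ⊆ {m | c < b i x m} ∧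
      c / 4 ≤ (cond ν (F (r x))).real E
    · obtain ⟨E, h1, h2⟩ := hE
      exact ⟨E, h1, fun _ => h2⟩
    · exact ⟨∅, MeasurableSet.empty, fun h => absurd h hE⟩
  choose E hE hEgood using sets
  obtain ⟨y, hy⟩ := exists_frequently_mem (fun x => cond ν (F (r x)))
    (fun x => by have := hκ x; simp) E hE (δ := c / 4) (by positivity)
    fun i => (good i).mono fun x hx => (hEgood i x hx).2
  set Q'' := Q ++ (starList Q ++ [((1 : ℕ → Γ → G), f)]).map
    fun p => (reduction (translate (fun x => a (r x)) y) g p.1, p.2) with hQ''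
  have eA : ∀ k x, ∫ n, prodOp ρ Q'' x (a k * n) v₀ ∂(cond ν (F k)) = A k x (y x) := by
    intro k x
    simp only [hQ'', hA, h.prodOp_append_reduction_apply, eW, eW']
    rfl
  have h1mem : ∀ p ∈ starList Q ++ [((1 : ℕ → Γ → G), f)], p.1 ∈ insert 1 S := by
    intro p hp
    rcases List.mem_append.1 hp with hp | hp
    · simp only [starList, List.mem_reverse, List.mem_map] at hp
      obtain ⟨q, hq, rfl⟩ := hp
      exact hQS q hq
    · rw [List.mem_singleton.1 hp]; exact Or.inl rfl
  have h1adm : IsAdmissible ρ B ν (starList Q ++ [((1 : ℕ → Γ → G), f)]) := by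
    intro p hp
    rcases List.mem_append.1 hp with hp | hp
    · exact h.isAdmissible_starList hQ p hp
    · rw [List.mem_singleton.1 hp]; exact ⟨isMeasFam_one, hf⟩
  obtain ⟨N, hN⟩ := hS (fun x => a (r x)) y Q'' (fun p hp => by
      rcases List.mem_append.1 hp with hp | hp
      · rcases hQS p hp with h | h
        · exact Or.inl h
        · exact Or.inr (Or.inl h)
      · obtain ⟨q, hq, rfl⟩ := List.mem_map.1 hp
        exact Or.inr (Or.inr ⟨q.1, h1mem q hq, rfl⟩)) (fun p hp => by
      rcases List.mem_append.1 hp with hp | hp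
      · exact hQ p hp
      · obtain ⟨q, hq, rfl⟩ := List.mem_map.1 hp
        exact ⟨h.isMeasFam_reduction hg (h1adm q hq).1 _ _, (h1adm q hq).2⟩) (c / 4)
    (by positivity)
  obtain ⟨i, hi, hix⟩ := hy N
  obtain ⟨x, h1, h2, h3⟩ := (hix.and ((good i).and
    (hN (k i) (hi.trans (hk i)) (l i) (hi.trans (hl i))))).exists
  have h4 : c < b i x (y x) := (hEgood i x h2).1 h1
  rw [eA, eA] at h3
  -- Convergence of the reduced system to within `c / 4`, together with `‖v i x‖ ≤ 2`, contradicts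
  -- `c < b i x (y x)`.
  have h5 : b i x (y x) ≤ 2 * (c / 4) := by
    simp only [hb, ← inner_sub_right]
    refine (RCLike.re_le_norm _).trans ((norm_inner_le_norm _ _).trans ?_)
    exact mul_le_mul (hv2 i x) h3 (norm_nonneg _) zero_le_two
  linarith

/-- Convergence of averages is inherited from all reductions. -/
theorem MultiplierSystem.isReducible_convergesOn (h : MultiplierSystem ρ B v₀)
    (hF : IsFolnerSeq ν a F) :
    IsReducible (translations ℕ Γ G) (ConvergesOn ρ B v₀ ν a F) where
  mono S T hST hT Q hQS hQ := hT Q (fun p hp => (hQS p hp).elim Or.inl fun h => hST h) hQ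
  base Q hQS hQ ε hε := by
    refine ⟨0, fun k _ l _ => Eventually.of_forall fun x => ?_⟩
    have e : ∀ n m, prodOp ρ Q x n = prodOp ρ Q x m := fun n m => by
      unfold prodOp
      congr 1
      refine List.map_congr_left fun p hp => ?_
      rcases hQS p hp with h | h
      · rw [h]; rfl
      · exact absurd h (Set.notMem_empty _)
    have hk := (hF.avg k).isProbabilityMeasure
    have hl := (hF.avg l).isProbabilityMeasure
    simp only [e _ 1, integral_const, probReal_univ, sub_self, norm_zero]
    exact hε.le
  step g S hS Q hQS hQ := by
    -- If `g` does not occur, nothing is known about its measurability, but any single reduced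
    -- system already contains all the mappings of `Q`.
    by_cases hgQ : ∃ p ∈ Q, p.1 = g
    swap
    · refine hS _ ⟨(1, 1), rfl⟩ Q (fun p hp => ?_) hQ
      rcases hQS p hp with h | h | h
      · exact Or.inl h
      · exact absurd ⟨p, hp, h⟩ hgQ
      · exact Or.inr (Or.inl h)
    obtain ⟨p, hp, rfl⟩ := hgQ
    set g := p.1
    have hg : IsMeasFam ρ ν g := (hQ p hp).1
    obtain ⟨Q', f, hQ'S, hQ', hf, eQ⟩ := h.factor g Q hQS hQ
    obtain ⟨W, eW⟩ : ∃ W : ℕ → Γ → H →L[𝕜] H, ∀ x n, W x n = prodOp ρ Q' x n * ρ (g x n) :=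
      ⟨_, fun _ _ => rfl⟩
    obtain ⟨W', eW'⟩ : ∃ W' : ℕ → Γ → H →L[𝕜] H,
        ∀ x n, W' x n = ρ (g x n)⁻¹ * prodOp ρ (starList Q') x n := ⟨_, fun _ _ => rfl⟩
    have hW : ∀ x, IsContractionField ν (W x) := fun x => by
      rw [funext (eW x)]
      exact (h.isContractionField_prodOp hQ' x).mul (h.isContractionField_rep hg x).1
    have hW' : ∀ x, IsContractionField ν (W' x) := fun x => by
      rw [funext (eW' x)]
      exact (h.isContractionField_rep hg x).2.mul
        (h.isContractionField_prodOp (h.isAdmissible_starList hQ') x)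
    have hWW' : ∀ x n, W' x n = star (W x n) := fun x n => by
      rw [eW, eW', star_mul, h.star_rep, h.star_prodOp]
    have hWD : ∀ x n, ∀ d ∈ (fun f : H →L[𝕜] H => f v₀) '' B,
        W x n d ∈ (fun f : H →L[𝕜] H => f v₀) '' B := by
      rintro x n _ ⟨f, hf, rfl⟩
      refine ⟨prodOp ρ Q' x n * (ρ (g x n) * f * ρ (g x n)⁻¹), h.mul_mem _
        (h.prodOp_mem (fun q hq => (hQ' q hq).2) x n) _ (h.conj_mem _ _ hf), ?_⟩
      simp [eW, h.fixed]
    have hWD' : ∀ x n, ∀ d ∈ (fun f : H →L[𝕜] H => f v₀) '' B,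
        W' x n d ∈ (fun f : H →L[𝕜] H => f v₀) '' B := by
      rintro x n _ ⟨f, hf, rfl⟩
      refine ⟨ρ (g x n)⁻¹ * (prodOp ρ (starList Q') x n * f) * ρ (g x n)⁻¹⁻¹, h.conj_mem _ _
        (h.mul_mem _ (h.prodOp_mem (fun q hq => (h.isAdmissible_starList hQ' q hq).2) x n) _ hf),
        ?_⟩
      simp [eW', h.fixed]
    have key := cauchyFam_of_structured 𝕜 (D := (fun f : H →L[𝕜] H => f v₀) '' B) h.convex
      (by rintro _ ⟨f, hf, rfl⟩; exact ⟨-f, h.neg_mem f hf, rfl⟩)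
      (by rintro _ ⟨f, hf, rfl⟩; exact h.norm_apply_vec_le hf)
      (T := fun k x => avgOp (hF.avg k) (hW x) (a k))
      (T' := fun k x => avgOp (hF.avg k) (hW' x) (a k))
      (fun k x u => norm_avgOp_le _ _ _ _) (fun k x u => norm_avgOp_le _ _ _ _)
      (fun k x d hd => avgOp_mem _ _ _ h.convex h.closed fun n => hWD x n d hd)
      (fun k x d hd => avgOp_mem _ _ _ h.convex h.closed fun n => hWD' x n d hd)
      (fun k x u w => inner_avgOp_star _ _ _ (hWW' x) _ _ _)
      (fun r hr d hd => by
        choose f' hf' hd' using hd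
        obtain rfl : (fun x => f' x v₀) = d := funext hd'
        exact h.cauchyFam_avgOp_star hF (fun b c => hS _ ⟨(b, c), rfl⟩) hg hQ'S hQ' hW hW' hWW'
          eW eW' hr hf')
      (fun x => f x v₀) (fun x => ⟨f x, hf x, rfl⟩)
    -- The trailing `ρ (g x n)⁻¹` disappears because `v₀` is invariant.
    have eQ' : ∀ x n, prodOp ρ Q x n v₀ = W x n (f x v₀) := fun x n => by
      simp [eQ, eW, h.fixed]
    simp only [eQ']
    exact key

/-- Convergence of averages along polynomial mappings for a sequence of averaging sets. -/
theorem MultiplierSystem.convergesOn_of_isPolynomialMap [Group.IsNilpotent G]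
    (h : MultiplierSystem ρ B v₀) (hF : IsFolnerSeq ν a F) {ι : Type*} [Finite ι] {g : ι → Γ → G}
    (hg : ∀ i, IsPolynomialMap (g i)) :
    ConvergesOn ρ B v₀ ν a F (Set.range fun i (_ : ℕ) => g i) :=
  (h.isReducible_convergesOn hF).of_isPolynomialMap g hg

end Reducible

/-! ### Multiplication operators on `L²` -/

section UnitaryRep

variable {𝕜 H : Type*} [RCLike 𝕜] [NormedAddCommGroup H] [InnerProductSpace 𝕜 H] [CompleteSpace H]

/-- The tautological representation of a group of unitary operators. -/
noncomputable def unitaryRep (G : Subgroup (H ≃ₗᵢ[𝕜] H)) : G →* (H →L[𝕜] H) :=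
  (Submonoid.subtype (unitary (H →L[𝕜] H))).comp
    ((Unitary.linearIsometryEquiv (𝕜 := 𝕜) (H := H)).symm.toMonoidHom.comp G.subtype)

theorem unitaryRep_apply (G : Subgroup (H ≃ₗᵢ[𝕜] H)) (U : G) (v : H) :
    unitaryRep G U v = (U : H ≃ₗᵢ[𝕜] H) v := rfl

theorem star_unitaryRep (G : Subgroup (H ≃ₗᵢ[𝕜] H)) (U : G) :
    star (unitaryRep G U) = unitaryRep G U⁻¹ := by
  simp only [unitaryRep, MonoidHom.comp_apply, map_inv]
  rfl

end UnitaryRep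

/-! ### Multiplication operators and the multiplier system of the `L^∞` unit ball. -/

section Multiplication

variable {𝕜 Ω : Type*} [RCLike 𝕜] [MeasurableSpace Ω] {μ : Measure Ω}

/-- `T` is the operator of multiplication by `φ`. -/
def IsMulOp (T : Lp 𝕜 2 μ →L[𝕜] Lp 𝕜 2 μ) (φ : Ω →ₘ[μ] 𝕜) : Prop :=
  ∀ h : Lp 𝕜 2 μ, ((T h : Lp 𝕜 2 μ) : Ω →ₘ[μ] 𝕜) = φ * h

theorem IsMulOp.coeFn {T : Lp 𝕜 2 μ →L[𝕜] Lp 𝕜 2 μ} {φ : Ω →ₘ[μ] 𝕜} (hT : IsMulOp T φ)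
    (h : Lp 𝕜 2 μ) : T h =ᵐ[μ] fun ω => φ ω * h ω := by
  rw [hT h]; exact AEEqFun.coeFn_mul _ _

theorem IsMulOp.of_coeFn {T : Lp 𝕜 2 μ →L[𝕜] Lp 𝕜 2 μ} {φ : Ω →ₘ[μ] 𝕜}
    (hT : ∀ h : Lp 𝕜 2 μ, T h =ᵐ[μ] fun ω => φ ω * h ω) : IsMulOp T φ := fun h =>
  AEEqFun.ext ((hT h).trans (AEEqFun.coeFn_mul _ _).symm)

theorem exists_isMulOp {φ : Ω →ₘ[μ] 𝕜} {C : ℝ} (hφ : ∀ᵐ ω ∂μ, ‖φ ω‖ ≤ C) :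
    ∃ T : Lp 𝕜 2 μ →L[𝕜] Lp 𝕜 2 μ, IsMulOp T φ := by
  have hmem : ∀ h : Lp 𝕜 2 μ, φ * (h : Ω →ₘ[μ] 𝕜) ∈ Lp 𝕜 2 μ := fun h => by
    rw [Lp.mem_Lp_iff_memLp]
    refine (memLp_congr_ae (AEEqFun.coeFn_mul _ _)).2 ?_
    exact (Lp.memLp h).mul (p := ∞) (memLp_top_of_bound φ.aestronglyMeasurable C hφ)
  have hcoe : ∀ h : Lp 𝕜 2 μ, ((⟨_, hmem h⟩ : Lp 𝕜 2 μ) : Ω → 𝕜) =ᵐ[μ] fun ω => φ ω * h ω :=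
    fun h => AEEqFun.coeFn_mul _ _
  refine ⟨LinearMap.mkContinuous
    { toFun := fun h => ⟨_, hmem h⟩
      map_add' := fun h k => ?_
      map_smul' := fun c h => ?_ } C fun h => ?_, fun h => rfl⟩
  · refine Lp.ext ?_
    filter_upwards [hcoe (h + k), hcoe h, hcoe k, Lp.coeFn_add h k,
      Lp.coeFn_add (⟨_, hmem h⟩ : Lp 𝕜 2 μ) ⟨_, hmem k⟩] with ω h1 h2 h3 h4 h5
    rw [h1, h5, h4, Pi.add_apply, Pi.add_apply, h2, h3, mul_add]
  · refine Lp.ext ?_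
    filter_upwards [hcoe (c • h), hcoe h, Lp.coeFn_smul c h,
      Lp.coeFn_smul c (⟨_, hmem h⟩ : Lp 𝕜 2 μ)] with ω h1 h2 h3 h4
    rw [RingHom.id_apply, h1, h4, h3, Pi.smul_apply, Pi.smul_apply, h2, smul_eq_mul, smul_eq_mul,
      mul_left_comm]
  · refine Lp.norm_le_mul_norm_of_ae_le_mul ?_
    filter_upwards [hcoe h, hφ] with ω h1 h2
    simp only [LinearMap.coe_mk, AddHom.coe_mk]
    rw [h1, norm_mul]
    gcongr

theorem IsMulOp.norm_le {T : Lp 𝕜 2 μ →L[𝕜] Lp 𝕜 2 μ} {φ : Ω →ₘ[μ] 𝕜} (hT : IsMulOp T φ)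
    {C : ℝ} (hC : 0 ≤ C) (hφ : ∀ᵐ ω ∂μ, ‖φ ω‖ ≤ C) : ‖T‖ ≤ C := by
  refine T.opNorm_le_bound hC fun h => Lp.norm_le_mul_norm_of_ae_le_mul ?_
  filter_upwards [hT.coeFn h, hφ] with ω h1 h2
  rw [h1, norm_mul]
  gcongr

theorem IsMulOp.mul {T T' : Lp 𝕜 2 μ →L[𝕜] Lp 𝕜 2 μ} {φ φ' : Ω →ₘ[μ] 𝕜} (hT : IsMulOp T φ)
    (hT' : IsMulOp T' φ') : IsMulOp (T * T') (φ * φ') := fun h => by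
  rw [mul_apply_eq_comp, hT, hT', mul_assoc]

theorem isMulOp_one : IsMulOp (1 : Lp 𝕜 2 μ →L[𝕜] Lp 𝕜 2 μ) 1 := fun h => by simp

theorem IsMulOp.ext {T T' : Lp 𝕜 2 μ →L[𝕜] Lp 𝕜 2 μ} {φ : Ω →ₘ[μ] 𝕜} (hT : IsMulOp T φ)
    (hT' : IsMulOp T' φ) : T = T' :=
  ContinuousLinearMap.ext fun h => Subtype.ext ((hT h).trans (hT' h).symm)

theorem IsMulOp.adjoint {T : Lp 𝕜 2 μ →L[𝕜] Lp 𝕜 2 μ} {φ : Ω →ₘ[μ] 𝕜} (hT : IsMulOp T φ)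
    {C : ℝ} (hφ : ∀ᵐ ω ∂μ, ‖φ ω‖ ≤ C) : IsMulOp (star T) (star φ) := by
  have hφ' : ∀ᵐ ω ∂μ, ‖(star φ : Ω →ₘ[μ] 𝕜) ω‖ ≤ C := by
    filter_upwards [hφ, AEEqFun.coeFn_star φ] with ω h1 h2
    rwa [h2, Pi.star_apply, norm_star]
  obtain ⟨T', hT'⟩ := exists_isMulOp hφ'
  have : T' = star T := by
    rw [ContinuousLinearMap.star_eq_adjoint, ContinuousLinearMap.eq_adjoint_iff]
    intro u v
    rw [L2.inner_def, L2.inner_def]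
    refine integral_congr_ae ?_
    filter_upwards [hT.coeFn v, hT'.coeFn u, AEEqFun.coeFn_star φ] with ω h1 h2 h3
    rw [h1, h2, h3]
    simp only [RCLike.inner_apply, Pi.star_apply, map_mul, RCLike.star_def, RCLike.conj_conj]
    ring
  exact this ▸ hT'

variable (𝕜 μ) in
/-- The multiplication operators by functions bounded by `1`. -/
def contractiveMulOps : Set (Lp 𝕜 2 μ →L[𝕜] Lp 𝕜 2 μ) :=
  {T | ∃ φ : Ω →ₘ[μ] 𝕜, (∀ᵐ ω ∂μ, ‖φ ω‖ ≤ 1) ∧ IsMulOp T φ}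

variable [IsProbabilityMeasure μ]

omit [IsProbabilityMeasure μ] in
theorem ae_norm_le_of_eLpNorm_le {φ : Ω → 𝕜} (h : eLpNorm φ ∞ μ ≤ 1) :
    ∀ᵐ ω ∂μ, ‖φ ω‖ ≤ 1 := by
  filter_upwards [ae_le_eLpNormEssSup (f := φ) (μ := μ)] with ω hω
  rw [eLpNorm_exponent_top] at h
  have := hω.trans h
  rwa [← ofReal_norm, ENNReal.ofReal_le_one] at this

omit [IsProbabilityMeasure μ] in
theorem eLpNorm_top_le_of_ae_norm_le {φ : Ω → 𝕜} (h : ∀ᵐ ω ∂μ, ‖φ ω‖ ≤ 1) :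
    eLpNorm φ ∞ μ ≤ 1 := by
  rw [eLpNorm_exponent_top]
  simpa using eLpNormEssSup_le_of_ae_bound h

variable (𝕜 μ) in
/-- The constant function `1` as an element of `L²`. -/
noncomputable def oneL2 : Lp 𝕜 2 μ := toL2 ⟨1, one_mem_LInfty⟩

theorem coe_oneL2 : (oneL2 𝕜 μ : Ω →ₘ[μ] 𝕜) = 1 := rfl

theorem memLp_top_oneL2 : MemLp (oneL2 𝕜 μ) ∞ μ :=
  Lp.memLp (⟨1, one_mem_LInfty⟩ : Lp 𝕜 ∞ μ)

theorem IsMulOp.apply_oneL2 {T : Lp 𝕜 2 μ →L[𝕜] Lp 𝕜 2 μ} {φ : Ω →ₘ[μ] 𝕜} (hT : IsMulOp T φ) :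
    ((T (oneL2 𝕜 μ) : Lp 𝕜 2 μ) : Ω →ₘ[μ] 𝕜) = φ := by
  rw [hT, coe_oneL2, mul_one]

omit [IsProbabilityMeasure μ] in
theorem ActsOnLInfty.memLp {U : Lp 𝕜 2 μ ≃ₗᵢ[𝕜] Lp 𝕜 2 μ} (hU : ActsOnLInfty U)
    {f : Lp 𝕜 2 μ} (hf : MemLp f ∞ μ) : MemLp (U f) ∞ μ :=
  ⟨Lp.aestronglyMeasurable _, by rw [hU.isometric f hf]; exact hf.2⟩

/-- With `q = U⁻¹ 1`, multiplicativity gives `1 = U q = U 1 · U q = U 1`. -/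
theorem ActsOnLInfty.apply_oneL2 {U : Lp 𝕜 2 μ ≃ₗᵢ[𝕜] Lp 𝕜 2 μ} (hU : ActsOnLInfty U)
    (hU' : ActsOnLInfty U⁻¹) : U (oneL2 𝕜 μ) = oneL2 𝕜 μ := by
  set q := U⁻¹ (oneL2 𝕜 μ) with hq
  have h1 : U q = oneL2 𝕜 μ := U.apply_symm_apply _
  have h2 := hU.map_mul (oneL2 𝕜 μ) q q memLp_top_oneL2 (hU'.memLp memLp_top_oneL2)
    (by rw [coe_oneL2, one_mul])
  rw [h1, coe_oneL2, mul_one] at h2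
  exact Subtype.ext h2.symm

omit [IsProbabilityMeasure μ] in
-- Multiplicativity of `U` is available only on bounded functions, so the identity is checked on
-- simple functions and extended by density and continuity.
theorem ActsOnLInfty.isMulOp_conj {U : Lp 𝕜 2 μ ≃ₗᵢ[𝕜] Lp 𝕜 2 μ} (hU : ActsOnLInfty U)
    (hU' : ActsOnLInfty U⁻¹) {V V' T : Lp 𝕜 2 μ →L[𝕜] Lp 𝕜 2 μ} (hV : ∀ h, V h = U h)
    (hV' : ∀ h, V' h = U⁻¹ h) {f : Lp 𝕜 2 μ} (hf : MemLp f ∞ μ)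
    (hT : IsMulOp T (f : Ω →ₘ[μ] 𝕜)) : IsMulOp (V * T * V') (U f : Ω →ₘ[μ] 𝕜) := by
  have hUf := hU.memLp hf
  obtain ⟨C, hC⟩ : ∃ C : ℝ, ∀ᵐ ω ∂μ, ‖U f ω‖ ≤ C := by
    refine ⟨(eLpNormEssSup (U f) μ).toReal, ?_⟩
    filter_upwards [ae_le_eLpNormEssSup (f := U f) (μ := μ)] with ω hω
    rw [← ofReal_norm] at hω
    exact (ENNReal.ofReal_le_iff_le_toReal (by simpa using hUf.2.ne)).1 hω
  obtain ⟨M, hM⟩ := exists_isMulOp hC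
  have hdense := Lp.simpleFunc.denseRange (E := 𝕜) (μ := μ) (p := 2) (by simp)
  have : V * T * V' = M := by
    refine ContinuousLinearMap.coeFn_injective
      (hdense.equalizer (V * T * V').continuous M.continuous (funext fun s => Subtype.ext ?_))
    have hs : MemLp (s : Lp 𝕜 2 μ) ∞ μ :=
      (memLp_congr_ae (Lp.simpleFunc.toSimpleFunc_eq_toFun s)).1
        ((Lp.simpleFunc.toSimpleFunc s).memLp_top μ)
    have h1 := hU.map_mul f (U⁻¹ (s : Lp 𝕜 2 μ)) (T (U⁻¹ (s : Lp 𝕜 2 μ))) hf (hU'.memLp hs)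
      (hT _)
    rw [Function.comp_apply, Function.comp_apply, hM, mul_apply_eq_comp,
      mul_apply_eq_comp, hV', hV, h1]
    have h2 : U (U⁻¹ (s : Lp 𝕜 2 μ)) = s := U.apply_symm_apply _
    rw [h2]
  exact this ▸ hM

theorem image_contractiveMulOps :
    (fun T : Lp 𝕜 2 μ →L[𝕜] Lp 𝕜 2 μ => T (oneL2 𝕜 μ)) '' contractiveMulOps 𝕜 μ =
      {v | ∀ᵐ ω ∂μ, ‖v ω‖ ≤ 1} := by
  ext v
  constructor
  · rintro ⟨T, ⟨φ, hφ, hT⟩, rfl⟩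
    simp only [Set.mem_ofPred_eq, hT.apply_oneL2]
    exact hφ
  · intro hv
    obtain ⟨T, hT⟩ := exists_isMulOp (φ := (v : Ω →ₘ[μ] 𝕜)) hv
    exact ⟨T, ⟨_, hv, hT⟩, Subtype.ext hT.apply_oneL2⟩

omit [IsProbabilityMeasure μ] in
-- An `L²`-convergent sequence has a subsequence converging almost everywhere, along which the
-- pointwise bound survives.
theorem isClosed_ae_norm_le_one : IsClosed {v : Lp 𝕜 2 μ | ∀ᵐ ω ∂μ, ‖v ω‖ ≤ 1} := by
  refine IsSeqClosed.isClosed fun u v hu huv => ?_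
  obtain ⟨s, -, hs⟩ := (tendstoInMeasure_of_tendsto_Lp huv).exists_seq_tendsto_ae
  filter_upwards [hs, ae_all_iff.2 hu] with ω h1 h2
  exact le_of_tendsto h1.norm (Eventually.of_forall fun n => h2 _)

omit [IsProbabilityMeasure μ] in
theorem convex_ae_norm_le_one : Convex ℝ {v : Lp 𝕜 2 μ | ∀ᵐ ω ∂μ, ‖v ω‖ ≤ 1} := by
  intro u hu v hv a b ha hb hab
  filter_upwards [hu, hv, Lp.coeFn_add (a • u) (b • v), Lp.coeFn_smul a u, Lp.coeFn_smul b v]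
    with ω h1 h2 h3 h4 h5
  rw [h3, Pi.add_apply, h4, h5, Pi.smul_apply, Pi.smul_apply]
  refine (norm_add_le _ _).trans ?_
  rw [norm_smul, norm_smul, Real.norm_of_nonneg ha, Real.norm_of_nonneg hb]
  nlinarith

variable {G : Subgroup (Lp 𝕜 2 μ ≃ₗᵢ[𝕜] Lp 𝕜 2 μ)}

theorem multiplierSystem_contractiveMulOps (hG : ∀ U ∈ G, ActsOnLInfty U) :
    MultiplierSystem (unitaryRep G) (contractiveMulOps 𝕜 μ) (oneL2 𝕜 μ) where
  star_rep := star_unitaryRep G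
  fixed U := (hG U U.2).apply_oneL2 (hG _ (U⁻¹).2)
  norm_vec := by
    have h1 : ∀ᵐ ω ∂μ, ‖oneL2 𝕜 μ ω‖ ≤ 1 := by
      filter_upwards [AEEqFun.coeFn_one (μ := μ) (α := Ω) (β := 𝕜)] with ω h
      rw [coe_oneL2, h]; simp
    simpa [measureUnivNNReal] using Lp.norm_le_of_ae_bound zero_le_one h1
  norm_le T := fun ⟨φ, hφ, hT⟩ => hT.norm_le zero_le_one hφ
  one_mem := ⟨1, by
    filter_upwards [AEEqFun.coeFn_one (μ := μ) (α := Ω) (β := 𝕜)] with ω h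
    rw [h]; simp, isMulOp_one⟩
  mul_mem := by
    rintro T ⟨φ, hφ, hT⟩ T' ⟨φ', hφ', hT'⟩
    refine ⟨φ * φ', ?_, hT.mul hT'⟩
    filter_upwards [hφ, hφ', AEEqFun.coeFn_mul φ φ'] with ω h1 h2 h3
    rw [h3, Pi.mul_apply, norm_mul]
    exact mul_le_one₀ h1 (norm_nonneg _) h2
  star_mem := by
    rintro T ⟨φ, hφ, hT⟩
    refine ⟨star φ, ?_, hT.adjoint hφ⟩
    filter_upwards [hφ, AEEqFun.coeFn_star φ] with ω h1 h2
    rwa [h2, Pi.star_apply, norm_star]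
  neg_mem := by
    rintro T ⟨φ, hφ, hT⟩
    refine ⟨-φ, ?_, IsMulOp.of_coeFn fun h => ?_⟩
    · filter_upwards [hφ, AEEqFun.coeFn_neg φ] with ω h1 h2
      rwa [h2, Pi.neg_apply, norm_neg]
    · filter_upwards [hT.coeFn h, AEEqFun.coeFn_neg φ, Lp.coeFn_neg (T h)] with ω h1 h2 h3
      rw [_root_.neg_apply, h3, h2, Pi.neg_apply, Pi.neg_apply, h1, neg_mul]
  conj_mem := by
    rintro U T ⟨φ, hφ, hT⟩
    have hφ' : eLpNorm φ ∞ μ ≤ 1 := eLpNorm_top_le_of_ae_norm_le hφ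
    have hmem : φ ∈ Lp 𝕜 ∞ μ := by
      rw [Lp.mem_Lp_iff_eLpNorm_lt_top]; exact hφ'.trans_lt ENNReal.one_lt_top
    set f : Lp 𝕜 2 μ := toL2 ⟨φ, hmem⟩ with hf
    have hfm : MemLp f ∞ μ := Lp.memLp (⟨φ, hmem⟩ : Lp 𝕜 ∞ μ)
    refine ⟨_, ?_, (hG U U.2).isMulOp_conj (hG _ (U⁻¹).2) (fun h => unitaryRep_apply G U h)
      (fun h => unitaryRep_apply G U⁻¹ h) hfm hT⟩
    refine ae_norm_le_of_eLpNorm_le ?_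
    rw [(hG U U.2).isometric f hfm]
    exact hφ'
  comm := by
    rintro T ⟨φ, hφ, hT⟩ T' ⟨φ', hφ', hT'⟩
    exact (hT.mul hT').ext (mul_comm φ φ' ▸ hT'.mul hT)
  closed := by rw [image_contractiveMulOps]; exact isClosed_ae_norm_le_one
  convex := by rw [image_contractiveMulOps]; exact convex_ae_norm_le_one

omit [IsProbabilityMeasure μ] in
theorem smul_aeEqFun_mul (c : 𝕜) (φ ψ : Ω →ₘ[μ] 𝕜) : c • φ * ψ = c • (φ * ψ) :=
  AEEqFun.induction_on₂ φ ψ fun f hf g hg => by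
    simp only [AEEqFun.smul_mk, AEEqFun.mk_mul_mk, smul_mul_assoc]

/-- The multiple products are obtained from products of conjugates of contractive multiplication
operators. -/
theorem exists_multipleProduct_eq (hG : ∀ U ∈ G, ActsOnLInfty U) {j : ℕ} (f₀ : Lp 𝕜 ∞ μ)
    (f : Fin j → Lp 𝕜 ∞ μ) :
    ∃ (T : Fin j → Lp 𝕜 2 μ →L[𝕜] Lp 𝕜 2 μ) (S : Lp 𝕜 2 μ →L[𝕜] Lp 𝕜 2 μ),
      (∀ i, T i ∈ contractiveMulOps 𝕜 μ) ∧ ∀ U : Fin j → G, multipleProduct hG f₀ f U =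
        S (((List.finRange j).map fun i =>
          unitaryRep G (U i) * T i * unitaryRep G (U i)⁻¹).prod (oneL2 𝕜 μ)) := by
  have : IsScalarTower 𝕜 (Ω →ₘ[μ] 𝕜) (Ω →ₘ[μ] 𝕜) := ⟨smul_aeEqFun_mul⟩
  have : SMulCommClass 𝕜 (Ω →ₘ[μ] 𝕜) (Ω →ₘ[μ] 𝕜) := ⟨fun c φ ψ => by
    rw [smul_eq_mul, smul_eq_mul, mul_comm φ, mul_comm φ, smul_aeEqFun_mul]⟩
  have bound : ∀ φ : Lp 𝕜 ∞ μ, ∀ᵐ ω ∂μ, ‖φ ω‖ ≤ ‖φ‖ := fun φ => by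
    filter_upwards [ae_le_eLpNormEssSup (f := φ) (μ := μ)] with ω hω
    rw [← ofReal_norm, ← eLpNorm_exponent_top] at hω
    exact (ENNReal.ofReal_le_iff_le_toReal (Lp.eLpNorm_ne_top φ)).1 hω
  -- Dividing `f i` by `‖f i‖ + 1` makes it a nonzero scaling into the unit ball, even for `f i =
  -- 0`. The product of these constants is returned to `f₀`, whose operator `S` need not be
  -- contractive.
  set c : Fin j → 𝕜 := fun i => ((‖f i‖ + 1 : ℝ) : 𝕜) with hc
  have hc1 : ∀ i, ‖c i‖ = ‖f i‖ + 1 := fun i => by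
    simp only [hc]
    rw [RCLike.norm_ofReal, abs_of_nonneg (by positivity)]
  have hc0 : ∀ i, c i ≠ 0 := fun i => by
    rw [← norm_ne_zero_iff, hc1]; positivity
  set f' : Fin j → Lp 𝕜 ∞ μ := fun i => (c i)⁻¹ • f i with hf'
  have hf'1 : ∀ i, ‖f' i‖ ≤ 1 := fun i => by
    rw [hf', norm_smul, norm_inv, hc1, inv_mul_le_one₀ (by positivity)]
    linarith
  choose T hT using fun i => exists_isMulOp (bound (f' i))
  obtain ⟨S, hS⟩ := exists_isMulOp (bound ((∏ i, c i) • f₀))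
  refine ⟨T, S, fun i => ⟨_, (bound (f' i)).mono fun ω h => h.trans (hf'1 i), hT i⟩,
    fun U => Subtype.ext ?_⟩
  have hconj : ∀ i, IsMulOp (unitaryRep G (U i) * T i * unitaryRep G (U i)⁻¹)
      ((c i)⁻¹ • (((U i : Lp 𝕜 2 μ ≃ₗᵢ[𝕜] Lp 𝕜 2 μ) (toL2 (f i)) : Lp 𝕜 2 μ) : Ω →ₘ[μ] 𝕜)) := by
    intro i
    have h1 := (hG _ (U i).2).isMulOp_conj (hG _ ((U i)⁻¹).2)
      (fun h => unitaryRep_apply G (U i) h) (fun h => unitaryRep_apply G (U i)⁻¹ h)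
      (f := toL2 (f' i)) (Lp.memLp (f' i)) (hT i)
    have h2 : toL2 (f' i) = (c i)⁻¹ • toL2 (f i) := rfl
    rw [h2, map_smul] at h1
    exact h1
  have hprod : ∀ l : List (Fin j), IsMulOp
      (l.map fun i => unitaryRep G (U i) * T i * unitaryRep G (U i)⁻¹).prod
      (l.map fun i => (c i)⁻¹ •
        (((U i : Lp 𝕜 2 μ ≃ₗᵢ[𝕜] Lp 𝕜 2 μ) (toL2 (f i)) : Lp 𝕜 2 μ) : Ω →ₘ[μ] 𝕜)).prod := by
    intro l
    induction l with
    | nil => exact isMulOp_one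
    | cons i l ih =>
      simp only [List.map_cons, List.prod_cons]
      exact (hconj i).mul ih
  rw [hS, (hprod _).apply_oneL2, ← Fin.prod_univ_def, Finset.prod_smul]
  change _ = ((∏ i, c i) • (f₀ : Ω →ₘ[μ] 𝕜)) * _
  rw [smul_mul_smul_comm, Finset.prod_inv_distrib,
    mul_inv_cancel₀ (Finset.prod_ne_zero_iff.2 fun i _ => hc0 i), one_smul]
  rfl

end Multiplication

/-! ### From sequences to nets -/

section Nets

variable {Γ : Type*} [Group Γ] [TopologicalSpace Γ] [IsTopologicalGroup Γ] [T2Space Γ]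
  [LocallyCompactSpace Γ] [MeasurableSpace Γ] [BorelSpace Γ] {ν : Measure Γ} [ν.IsHaarMeasure]

/-- The averaging sets with shifts that are almost invariant under all elements of a set. -/
def almostInvariant (ν : Measure Γ) (i : Set Γ × ℝ) : Set (Γ × Set Γ) :=
  {p | IsAvgSet ν p.2 ∧ ∀ l ∈ i.1, ν.real ((l • p.2) ∆ p.2) ≤ i.2 * ν.real p.2}

omit [IsTopologicalGroup Γ] [T2Space Γ] [LocallyCompactSpace Γ] [BorelSpace Γ]
  [ν.IsHaarMeasure] in
theorem almostInvariant_subset {K K' : Set Γ} {δ δ' : ℝ} (hK : K ⊆ K') (hδ : δ' ≤ δ) :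
    almostInvariant ν (K', δ') ⊆ almostInvariant ν (K, δ) := fun p hp =>
  ⟨hp.1, fun l hl => (hp.2 l (hK hl)).trans (by
    simp only
    gcongr)⟩

omit [T2Space Γ] [LocallyCompactSpace Γ] [BorelSpace Γ] [ν.IsHaarMeasure] in
/-- A function of averaging sets that is Cauchy along all sequences of almost invariant sets is
uniformly Cauchy. -/
theorem exists_almostInvariant_norm_sub_le {H : Type*} [NormedAddCommGroup H] (S : Γ × Set Γ → H)
    (hS : ∀ (a : ℕ → Γ) (F : ℕ → Set Γ), IsFolnerSeq ν a F → ∀ ε : ℝ, 0 < ε →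
      ∃ N, ∀ k ≥ N, ∀ l ≥ N, ‖S (a k, F k) - S (a l, F l)‖ ≤ ε) {ε : ℝ} (hε : 0 < ε) :
    ∃ K : Set Γ, IsCompact K ∧ ∃ δ : ℝ, 0 < δ ∧ ∀ p ∈ almostInvariant ν (K, δ),
      ∀ q ∈ almostInvariant ν (K, δ), ‖S p - S q‖ ≤ ε := by
  by_contra! hcon
  have hcon' : ∀ (K : {K : Set Γ // IsCompact K}) (n : ℕ), ∃ p q : Γ × Set Γ,
      p ∈ almostInvariant ν (K, 1 / (n + 1 : ℝ)) ∧ q ∈ almostInvariant ν (K, 1 / (n + 1 : ℝ)) ∧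
        ε < ‖S p - S q‖ := fun K n => by
    obtain ⟨p, hp, q, hq, h⟩ := hcon K K.2 (1 / (n + 1 : ℝ)) (by positivity)
    exact ⟨p, q, hp, hq, h⟩
  choose P Q hP hQ hPQ using hcon'
  -- Each compact set swallows the shifted averaging sets just chosen, so that all later sets are
  -- almost invariant under them.
  let next : ℕ → {K : Set Γ // IsCompact K} → {K : Set Γ // IsCompact K} := fun n K =>
    ⟨K ∪ ((P K n).1 • (P K n).2 ∪ (Q K n).1 • (Q K n).2),
      K.2.union (((hP K n).1.isCompact.smul _).union ((hQ K n).1.isCompact.smul _))⟩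
  let K : ℕ → {K : Set Γ // IsCompact K} := fun n => Nat.rec ⟨∅, isCompact_empty⟩ next n
  have hK : ∀ n, K (n + 1) = next n (K n) := fun n => rfl
  have hmono : Monotone fun n => (K n).1 := monotone_nat_of_le_succ fun n => by
    rw [hK]; exact Set.subset_union_left
  -- Interleaving the two choices yields one sequence in which the terms `2N` and `2N + 1` stay more
  -- than `ε` apart.
  let s : ℕ → Γ × Set Γ := fun i =>
    if i % 2 = 0 then P (K (i / 2)) (i / 2) else Q (K (i / 2)) (i / 2)
  have hs : ∀ i, s i ∈ almostInvariant ν ((K (i / 2)).1, 1 / ((i / 2 : ℕ) + 1 : ℝ)) := fun i => by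
    by_cases h : i % 2 = 0
    · simp only [s, h, if_true]; exact hP _ _
    · simp only [s, h, if_false]; exact hQ _ _
  have hsK : ∀ i, (s i).1 • (s i).2 ⊆ (K (i / 2 + 1)).1 := fun i => by
    rw [hK]
    by_cases h : i % 2 = 0
    · simp only [s, h, if_true]
      exact Set.subset_union_left.trans Set.subset_union_right
    · simp only [s, h, if_false]
      exact Set.subset_union_right.trans Set.subset_union_right
  have hF : IsFolnerSeq ν (fun i => (s i).1) (fun i => (s i).2) := by
    refine ⟨fun i => (hs i).1, fun k η hη => ?_⟩
    obtain ⟨M, hM⟩ := exists_nat_one_div_lt hη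
    filter_upwards [eventually_ge_atTop (2 * max M (k / 2 + 1))] with N hN l hl
    have h1 : max M (k / 2 + 1) ≤ N / 2 := by omega
    refine (almostInvariant_subset (hmono ((le_max_right _ _).trans h1)) ?_ (hs N)).2 l (hsK k hl)
    refine le_trans ?_ hM.le
    have h2 : (M : ℝ) ≤ (N / 2 : ℕ) := by exact_mod_cast (le_max_left _ _).trans h1
    gcongr
  obtain ⟨N, hN⟩ := hS _ _ hF ε hε
  have h1 := hN (2 * N) (by omega) (2 * N + 1) (by omega)
  have e1 : s (2 * N) = P (K N) N := by
    have h2 : 2 * N % 2 = 0 := by omega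
    have h3 : 2 * N / 2 = N := by omega
    simp only [s, h2, h3, if_true]
  have e2 : s (2 * N + 1) = Q (K N) N := by
    have h2 : (2 * N + 1) % 2 ≠ 0 := by omega
    have h3 : (2 * N + 1) / 2 = N := by omega
    simp only [s, h2, h3, if_false]
  simp only [Prod.mk.eta, e1, e2] at h1
  exact absurd (hPQ (K N) N) (not_lt.2 h1)

omit [LocallyCompactSpace Γ] [BorelSpace Γ] [T2Space Γ] [IsTopologicalGroup Γ] in
theorem IsFolnerNet.eventually_mem_almostInvariant {A : Type*} [Preorder A] {F : A → Set Γ}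
    (hF : IsFolnerNet ν F) (a : A → Γ) {K : Set Γ} (hK : IsCompact K) {δ : ℝ} (hδ : 0 < δ) :
    ∀ᶠ α in atTop, (a α, F α) ∈ almostInvariant ν (K, δ) := by
  filter_upwards [(hF.tendsto_sup K hK).eventually_le_const (ENNReal.ofReal_pos.2 hδ)] with α hα
  have havg : IsAvgSet ν (F α) := ⟨hF.isCompact α, hF.measure_pos α⟩
  refine ⟨havg, fun l hl => ?_⟩
  have h1 := (le_iSup₂ (f := fun l _ => ν ((l • F α) ∆ F α) / ν (F α)) l hl).trans hα
  have hfin : ν (F α) ≠ ∞ := (hF.isCompact α).measure_lt_top.ne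
  rw [ENNReal.div_le_iff (hF.measure_pos α).ne' hfin] at h1
  have h2 := ENNReal.toReal_mono (ENNReal.mul_ne_top ENNReal.ofReal_ne_top hfin) h1
  rwa [ENNReal.toReal_mul, ENNReal.toReal_ofReal hδ.le] at h2

omit [T2Space Γ] [LocallyCompactSpace Γ] [BorelSpace Γ] in
-- The limit is taken along the filter generated by the sets `almostInvariant ν i`, which involves
-- no net and leaves the shifts unrestricted.
theorem exists_tendsto_of_isFolnerSeq {H : Type*} [NormedAddCommGroup H] [CompleteSpace H]
    (S : Γ × Set Γ → H)
    (hS : ∀ (a : ℕ → Γ) (F : ℕ → Set Γ), IsFolnerSeq ν a F → ∀ ε : ℝ, 0 < ε →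
      ∃ N, ∀ k ≥ N, ∀ l ≥ N, ‖S (a k, F k) - S (a l, F l)‖ ≤ ε) :
    ∃ L : H, ∀ (A : Type*) [Preorder A] (F : A → Set Γ), IsFolnerNet ν F → ∀ a : A → Γ,
      Tendsto (fun α => S (a α, F α)) atTop (𝓝 L) := by
  let 𝓕 : Filter (Γ × Set Γ) :=
    ⨅ (i : Set Γ × ℝ) (_ : IsCompact i.1 ∧ 0 < i.2), 𝓟 (almostInvariant ν i)
  have hbasis : 𝓕.HasBasis (fun i : Set Γ × ℝ => IsCompact i.1 ∧ 0 < i.2) (almostInvariant ν) :=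
    hasBasis_biInf_principal'
      (fun i hi j hj => ⟨(i.1 ∪ j.1, min i.2 j.2), ⟨hi.1.union hj.1, lt_min hi.2 hj.2⟩,
        almostInvariant_subset Set.subset_union_left (min_le_left _ _),
        almostInvariant_subset Set.subset_union_right (min_le_right _ _)⟩)
      ⟨(∅, 1), isCompact_empty, one_pos⟩
  obtain ⟨L, hL⟩ : ∃ L, Tendsto S 𝓕 (𝓝 L) := by
    rcases eq_or_neBot 𝓕 with h | h
    -- If the filter is trivial, any value serves as limit.
    · exact ⟨0, by rw [h]; exact tendsto_bot⟩
    · refine cauchy_map_iff_exists_tendsto.1 ⟨h.map S, ?_⟩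
      rw [((hbasis.map S).prod_self).le_basis_iff Metric.uniformity_basis_dist_le]
      intro ε hε
      obtain ⟨K, hK, δ, hδ, hKδ⟩ := exists_almostInvariant_norm_sub_le S hS hε
      refine ⟨(K, δ), ⟨hK, hδ⟩, ?_⟩
      rintro ⟨_, _⟩ ⟨⟨p, hp, rfl⟩, ⟨q, hq, rfl⟩⟩
      simpa [dist_eq_norm] using hKδ p hp q hq
  refine ⟨L, fun A _ F hF a => hL.comp ?_⟩
  rw [hbasis.tendsto_right_iff]
  exact fun i hi => hF.eventually_mem_almostInvariant a hi.1 hi.2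

omit [T2Space Γ] [LocallyCompactSpace Γ] in
theorem average_smul_set {E : Type*} [NormedAddCommGroup E] [NormedSpace ℝ E] (φ : Γ → E)
    (F : Set Γ) (a : Γ) :
    (ν.real (a • F))⁻¹ • ∫ m in a • F, φ m ∂ν = ∫ n, φ (a * n) ∂(ProbabilityTheory.cond ν F) := by
  have h1 : ∫ m in F, φ (a * m) ∂ν = ∫ m in a • F, φ m ∂ν :=
    ((measurePreserving_mul_left ν a).setIntegral_image_emb
      (MeasurableEquiv.mulLeft a).measurableEmbedding φ F).symm
  rw [integral_cond_eq, h1, measureReal_def, measureReal_def, measure_smul]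

end Nets

end NilpotentErgodic

/-- The group `Γ` is locally compact with left Haar measure `ν`. Amenability of `Γ` is the
existence of a Følner net and need not be assumed separately. The limit `L` is chosen before the
Følner net and the shifts, so it depends on neither. -/
theorem theorem1 {𝕜 : Type*} [RCLike 𝕜]
    {Γ : Type*} [Group Γ] [TopologicalSpace Γ] [IsTopologicalGroup Γ] [T2Space Γ]
    [LocallyCompactSpace Γ] [MeasurableSpace Γ] [BorelSpace Γ]
    (ν : Measure Γ) [ν.IsHaarMeasure] [ν.Regular]
    {Ω : Type*} [MeasurableSpace Ω] (μ : Measure Ω) [IsProbabilityMeasure μ]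
    (G : Subgroup (Lp 𝕜 2 μ ≃ₗᵢ[𝕜] Lp 𝕜 2 μ)) [Group.IsNilpotent G]
    (hG : ∀ U ∈ G, NilpotentErgodic.ActsOnLInfty U)
    (j : ℕ) (g : Fin j → Γ → G)
    (hg_meas : ∀ i, NilpotentErgodic.IsMeasurableMap ν (g i))
    (hg_poly : ∀ i, NilpotentErgodic.IsPolynomialMap (g i))
    (f₀ : Lp 𝕜 ∞ μ) (f : Fin j → Lp 𝕜 ∞ μ) :
    ∃ L : Lp 𝕜 2 μ, ∀ (A : Type*) [Preorder A] [IsDirectedOrder A] [Nonempty A]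
      (F : A → Set Γ), NilpotentErgodic.IsFolnerNet ν F → ∀ a : A → Γ,
        (∀ α, IntegrableOn
          (fun m => NilpotentErgodic.multipleProduct hG f₀ f (fun i => g i m))
          (a α • F α) ν) ∧
        Tendsto (fun α => (ν.real (a α • F α))⁻¹ •
            ∫ m in a α • F α, NilpotentErgodic.multipleProduct hG f₀ f (fun i => g i m) ∂ν)
          atTop (𝓝 L) := by
  open NilpotentErgodic in
  obtain ⟨T, S, hT, hTS⟩ := exists_multipleProduct_eq hG f₀ f
  have hB := multiplierSystem_contractiveMulOps hG
  let Q : List ((ℕ → Γ → G) × (ℕ → Lp 𝕜 2 μ →L[𝕜] Lp 𝕜 2 μ)) :=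
    (List.finRange j).map fun i => (fun _ => g i, fun _ => T i)
  have hQ : IsAdmissible (unitaryRep G) (contractiveMulOps 𝕜 μ) ν Q := by
    intro p hp
    obtain ⟨i, -, rfl⟩ := List.mem_map.1 hp
    exact ⟨fun _ v => ⟨fun K hK => (hg_meas i v K hK).1, fun K hK => (hg_meas i v K hK).2⟩,
      fun _ => hT i⟩
  have hQS : ∀ p ∈ Q, p.1 ∈ insert 1 (Set.range fun i (_ : ℕ) => g i) := by
    intro p hp
    obtain ⟨i, -, rfl⟩ := List.mem_map.1 hp
    exact Or.inr ⟨i, rfl⟩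
  let Φ : Γ → Lp 𝕜 2 μ := fun m => prodOp (unitaryRep G) Q 0 m (oneL2 𝕜 μ)
  have hΦ : ∀ m, multipleProduct hG f₀ f (fun i => g i m) = S (Φ m) := fun m => by
    rw [hTS]
    simp only [Φ, prodOp, Q, List.map_map]
    rfl
  have hΦm : BddMeas ν Φ ‖oneL2 𝕜 μ‖ := (hB.isContractionField_prodOp hQ 0).bddMeas _
  have hΦi : ∀ E : Set Γ, IsCompact E → IntegrableOn Φ E ν := fun E hE => by
    have : IsFiniteMeasure (ν.restrict E) := ⟨by simpa using hE.measure_lt_top⟩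
    exact Integrable.of_bound (hΦm.meas E hE) _ (Eventually.of_forall hΦm.bdd)
  obtain ⟨L, hL⟩ := exists_tendsto_of_isFolnerSeq (ν := ν)
    (fun p : Γ × Set Γ => ∫ n, Φ (p.1 * n) ∂(ProbabilityTheory.cond ν p.2))
    fun a F hF ε hε => by
      obtain ⟨N, hN⟩ := hB.convergesOn_of_isPolynomialMap hF hg_poly Q hQS hQ ε hε
      refine ⟨N, fun k hk l hl => ?_⟩
      -- All data are constant in `x`, so a single good `x` gives the estimate.
      obtain ⟨x, hx⟩ := (hN k hk l hl).exists
      have e : ∀ n, prodOp (unitaryRep G) Q x n = prodOp (unitaryRep G) Q 0 n := fun n => by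
        simp only [prodOp, Q, List.map_map]
        rfl
      simpa only [e] using hx
  refine ⟨S L, fun A _ _ _ F hF a => ?_⟩
  have hc : ∀ α, IsCompact (a α • F α) := fun α => (hF.isCompact α).smul _
  simp only [hΦ]
  refine ⟨fun α => S.integrable_comp (hΦi _ (hc α)), ?_⟩
  have e : ∀ α, (ν.real (a α • F α))⁻¹ • ∫ m in a α • F α, S (Φ m) ∂ν =
      S (∫ n, Φ (a α * n) ∂(ProbabilityTheory.cond ν (F α))) := fun α => by
    rw [S.integral_comp_comm (hΦi _ (hc α)), ← average_smul_set,
      RCLike.real_smul_eq_coe_smul (K := 𝕜), RCLike.real_smul_eq_coe_smul (K := 𝕜), map_smul]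
  simp only [e]
  exact (S.continuous.tendsto L).comp (hL A F hF a)
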